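/- **Proposition (cubic Zakharov–Kuznetsov resonance, $d\ge 3$).** Let $d\ge 3$, $s>\frac d2-1$ and $\epsilon<\min\{2s-d+2,\,1\}$. For $\xi=(\xi^1,\dots,\xi^d)\in\mathbb R^d$ put $L(\xi)=\xi^1|\xi|^2$, $\langle\xi\rangle=(1+|\xi|^2)^{1/2}$, write $\xi_0=\xi$, and let $$\Phi=L(\xi)-L(\xi_1)-L(\xi_2)-L(\xi_3).$$ Let the multiplier $m$ be either $m=|\xi|$ or $m=\xi_1^1+\xi_2^1+\xi_3^1$ (the symbol of $\partial_{x}$ up to a unimodular factor). Then the flexible frequency-restricted estimate with avoided values $c\in\{2,-2\}$ of $\sigma/\xi$ holds, in the following sense. Both $c=2$ and $c=-2$ are avoidable: $c\ne 1-\frac3N$ for every integer $N\ge 3$. For $K>0$, $\kappa>1$, $\delta>0$, $\sigma\in\mathbb R^d$ and $c\in\mathbb R$ let $\Gamma^{\sigma}(c)$ be the set of $(\xi,\xi_1,\xi_2,\xi_3)\in(\mathbb R^d)^4$ such that * $\xi+\sigma=\xi_1+\xi_2+\xi_3$ and $|\sigma|\le K\min_{1\le j\le 3}|\xi_j|$;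 * if $|\xi_i|\le\kappa|\xi_j|$ for all $i,j\in\{1,2,3\}$, then $|\sigma-c\,\xi|\ge\delta|\xi|$. Then for all $K>0$, $\kappa>1$, $\delta>0$ there are $\eta>0$, $C$, and a finite cover of $(\mathbb R^d)^4$ by measurable regions $R$ such that for each region $R$ there exist $c\in\{2,-2\}$, a set $\emptyset\ne A\subsetneq\{0,1,2,3\}$ with complement $A^c$, and real numbers $s_j,s_j'$ $(0\le j\le 3)$, $\epsilon_0,\epsilon_0'$ with $$s_j+s_j'=2s\quad(0\le j\le 3),\qquad \epsilon_0+\epsilon_0'=2\epsilon,$$ for which, for every $M\ge1$, $$\sup_{\sigma,\;\alpha,\;\xi_{j\in A}}\ \int_{\Gamma^\sigma(c)\cap R}\frac{|m|\,\langle\xi\rangle^{s_0+\epsilon_0}}{\prod_{j=1}^3\langle\xi_j\rangle^{s_j}}\,\mathbf 1_{|\Phi-\alpha|<M}\;d\xi_{j\in A^c}\ \le\ C\,M^{1-\eta}$$ and $$\sup_{\sigma,\;\alpha,\;\xi_{j\in A^c}}\ \int_{\Gamma^\sigma(c)\cap R}\frac{|m|\,\langle\xi\rangle^{s_0'+\epsilon_0'}}{\prod_{j=1}^3\langle\xi_j\rangle^{s_j'}}\,\mathbf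 1_{|\Phi-\alpha|<M}\;d\xi_{j\in A}\ \le\ C\,M^{1-\eta}.$$ Here $\sigma\in\mathbb R^d$ and $\alpha\in\mathbb R$ are arbitrary. In each integral the frequencies under the supremum are frozen and one integrates over the others subject to $\xi+\sigma=\xi_1+\xi_2+\xi_3$, i.e. one of them is eliminated by this equation and the measure is Lebesgue measure in the rest (if only one frequency is not frozen, the integral is the value of the integrand at the point that the equation determines). -/

import Mathlib

open MeasureTheory
open scoped ENNReal

noncomputable section

namespace FlexFRE

/-- The frequency space `ℝᵈ` with its Euclidean norm. -/
abbrev Freq (d : ℕ) : Type := EuclideanSpace ℝ (Fin d)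

/-- Configurations `x = (ξ, ξ₁, …, ξ_k)` of frequencies: `x 0 = ξ = ξ₀` is the outgoing frequency and
`x j.succ` are the `k` ingoing ones. -/
abbrev Config (k d : ℕ) : Type := Fin (k + 1) → Freq d

/-- The Japanese bracket `⟨ξ⟩ = (1 + |ξ|²)^{1/2}`. -/
def jap {d : ℕ} (ξ : Freq d) : ℝ := Real.sqrt (1 + ‖ξ‖ ^ 2)

/-- The resonance function `Φ = L(ξ) - ∑_{j=1}^k L(ξ_j)` (no complex conjugates). -/
def resonance {k d : ℕ} (L : Freq d → ℝ) (x : Config k d) : ℝ :=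
  L (x 0) - ∑ j : Fin k, L (x j.succ)

/-- The convolution hyperplane with deformation `σ`, where `K` is the implicit constant:
`ξ + σ = ξ₁ + ⋯ + ξ_k` and `|σ| ≤ K |ξ_j|` for every `1 ≤ j ≤ k`. -/
def Gam {k d : ℕ} (K : ℝ) (σ : Freq d) : Set (Config k d) :=
  {x | x 0 + σ = ∑ j : Fin k, x j.succ ∧ ∀ j : Fin k, ‖σ‖ ≤ K * ‖x j.succ‖}

/-- The condition "`|ξ₁| ∼ ⋯ ∼ |ξ_k|` implies `σ ≄ c ξ`". Here `κ` is the constant in `∼`, and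
`σ ≃ c ξ` means `|σ - c ξ| < δ |ξ|`. -/
def Avoid {k d : ℕ} (κ δ c : ℝ) (σ : Freq d) : Set (Config k d) :=
  {x | (∀ i j : Fin k, ‖x i.succ‖ ≤ κ * ‖x j.succ‖) → δ * ‖x 0‖ ≤ ‖σ - c • x 0‖}

/-- The avoidable values of `σ/ξ` at order `k`: the real numbers `c` that differ from `1 - k/K` for
all integers `K ≥ k`. -/
def IsAvoidable (k : ℕ) (c : ℝ) : Prop :=
  ∀ K : ℕ, k ≤ K → c ≠ 1 - (k : ℝ) / (K : ℝ)

/-- The weight `|m| ⟨ξ⟩^{t 0 + e} / ∏_{j=1}^k ⟨ξ_j⟩^{t j}`. -/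
def weight {k d : ℕ} (m : Config k d → ℝ) (t : Fin (k + 1) → ℝ) (e : ℝ) (x : Config k d) : ℝ :=
  |m x| * jap (x 0) ^ (t 0 + e) / ∏ j : Fin k, jap (x j.succ) ^ t j.succ

/-- The amount by which `x` misses the hyperplane `ξ + σ = ξ₁ + ⋯ + ξ_k`. -/
def defect {k d : ℕ} (σ : Freq d) (x : Config k d) : Freq d :=
  x 0 + σ - ∑ j : Fin k, x j.succ

/-- The configuration with `x_j = z_j` for `j ∉ B`, `x_j = y_j` for `j ∈ B`, `j ≠ j₀`, and `0` in
position `j₀`. -/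
def partialPoint {k d : ℕ} (B : Finset (Fin (k + 1))) (j₀ : Fin (k + 1)) (z : Config k d)
    (y : ↥(B.erase j₀) → Freq d) : Config k d :=
  fun j => if h : j ∈ B.erase j₀ then y ⟨j, h⟩ else if j = j₀ then 0 else z j

/-- The point of the hyperplane `ξ + σ = ξ₁ + ⋯ + ξ_k` with `x_j = z_j` for `j ∉ B` (the frozen
frequencies) and `x_j = y_j` for `j ∈ B`, `j ≠ j₀`; the remaining frequency `x_{j₀}` is determined
by the equation. -/
def slicePoint {k d : ℕ} (B : Finset (Fin (k + 1))) (j₀ : Fin (k + 1)) (σ : Freq d)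
    (z : Config k d) (y : ↥(B.erase j₀) → Freq d) : Config k d :=
  Function.update (partialPoint B j₀ z y) j₀
    (if j₀ = 0 then -defect σ (partialPoint B j₀ z y) else defect σ (partialPoint B j₀ z y))

/-- `slicePoint` lies on the hyperplane. -/
theorem slicePoint_sum {k d : ℕ} (B : Finset (Fin (k + 1))) (j₀ : Fin (k + 1)) (σ : Freq d)
    (z : Config k d) (y : ↥(B.erase j₀) → Freq d) :
    slicePoint B j₀ σ z y 0 + σ = ∑ j : Fin k, slicePoint B j₀ σ z y j.succ := by
  have hz : partialPoint B j₀ z y j₀ = 0 := by simp [partialPoint]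
  rcases Fin.eq_zero_or_eq_succ j₀ with rfl | ⟨i, rfl⟩
  · simp only [slicePoint, if_true, Function.update_self, defect, hz]
    simp [Function.update_of_ne, Fin.succ_ne_zero]
  · have h0 : (0 : Fin (k + 1)) ≠ i.succ := (Fin.succ_ne_zero i).symm
    simp only [slicePoint, Fin.succ_ne_zero, if_false, Function.update_of_ne h0]
    have hu : ∀ (w : Freq d) (j : Fin k),
        Function.update (partialPoint B i.succ z y) i.succ w j.succ
          = Function.update (fun j : Fin k => partialPoint B i.succ z y j.succ) i w j := by
      intro w j
      by_cases h : j = i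
      · subst h; simp
      · rw [Function.update_of_ne h, Function.update_of_ne (fun hh => h (Fin.succ_injective _ hh))]
    simp only [hu]
    rw [Finset.sum_update_of_mem (Finset.mem_univ i), defect,
      ← Finset.sum_sdiff (Finset.subset_univ ({i} : Finset (Fin k)))]
    simp [hz]

/-- `slicePoint` has the frozen frequencies `z_j`, `j ∉ B`. -/
theorem slicePoint_of_notMem {k d : ℕ} {B : Finset (Fin (k + 1))} {j₀ : Fin (k + 1)}
    (h₀ : j₀ ∈ B) (σ : Freq d) (z : Config k d) (y : ↥(B.erase j₀) → Freq d)
    {j : Fin (k + 1)} (hj : j ∉ B) : slicePoint B j₀ σ z y j = z j := by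
  have hne : j ≠ j₀ := fun h => hj (h ▸ h₀)
  simp [slicePoint, partialPoint, hj, hne]

/-- The frequency-restricted estimate
`sup_{σ, α, x_{j ∉ B}} ∫_{D_σ} W 1_{|Φ - α| < M} dx_{j ∈ B} ≤ C M^{1-η}` for all `M ≥ 1`.
The frequencies `x_j`, `j ∉ B`, are frozen, and one integrates over the `x_j`, `j ∈ B`, on the
hyperplane `ξ + σ = ξ₁ + ⋯ + ξ_k`: one of them, `x_{j₀}`, is eliminated, and the measure is Lebesgue
measure in the others. All coefficients in the equation being `± 1`, the value of the integral does
not depend on which one is eliminated. If `B = {j₀}`, the integral is the value at the only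
point. -/
def Estimate {k d : ℕ} (L : Freq d → ℝ) (D : Freq d → Set (Config k d)) (W : Config k d → ℝ)
    (B : Finset (Fin (k + 1))) (C η : ℝ) : Prop :=
  ∀ j₀ ∈ B, ∀ (σ : Freq d) (α : ℝ) (z : Config k d) (M : ℝ), 1 ≤ M →
    ∫⁻ y : ↥(B.erase j₀) → Freq d,
      (D σ ∩ {x | |resonance L x - α| < M}).indicator (fun x => ENNReal.ofReal (W x))
        (slicePoint B j₀ σ z y) ≤ ENNReal.ofReal (C * M ^ (1 - η))

/-- The flexible frequency-restricted estimate at regularity `s` with gain `ε`, for the dispersion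
symbol `L`, the nonlinear multiplier `m`, and the finite set `S` of avoided values of `σ/ξ`.

`K`, `κ`, `δ` are the constants in `|σ| ≲ min |ξ_j|`, in `|ξ₁| ∼ ⋯ ∼ |ξ_k|` and in `σ ≃ c ξ`; they are
arbitrary. The set `A`, the exponents, and the avoided value may depend on the region of the
frequency space; the regions `R i` are measurable and finite in number, and cover everything. -/
def FlexibleEstimate {k d : ℕ} (L : Freq d → ℝ) (m : Config k d → ℝ) (S : Finset ℝ) (s ε : ℝ) :
    Prop :=
  (∀ c ∈ S, IsAvoidable k c) ∧
  ∀ K κ δ : ℝ, 0 < K → 1 < κ → 0 < δ →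
    ∃ (η C : ℝ) (n : ℕ) (R : Fin n → Set (Config k d)),
      0 < η ∧ (∀ i, MeasurableSet (R i)) ∧ (⋃ i, R i) = Set.univ ∧
      ∀ i : Fin n, ∃ (c : ℝ) (A : Finset (Fin (k + 1))) (t t' : Fin (k + 1) → ℝ) (e e' : ℝ),
        c ∈ S ∧ A.Nonempty ∧ A ≠ Finset.univ ∧
        (∀ j, t j + t' j = 2 * s) ∧ e + e' = 2 * ε ∧
        Estimate L (fun σ => R i ∩ (Gam K σ ∩ Avoid κ δ c σ)) (weight m t e) Aᶜ C η ∧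
        Estimate L (fun σ => R i ∩ (Gam K σ ∩ Avoid κ δ c σ)) (weight m t' e') A C η

/-- The Zakharov–Kuznetsov symbol `L(ξ) = ξ¹ |ξ|²`. -/
def zkSymbol {d : ℕ} (hd : 0 < d) (ξ : Freq d) : ℝ := ξ ⟨0, hd⟩ * ‖ξ‖ ^ 2

/-- The size `|ξ|` of the outgoing frequency. -/
def outSize {k d : ℕ} (x : Config k d) : ℝ := ‖x 0‖

/-- The symbol `(ξ₁ + ⋯ + ξ_k)¹` of `∂_x (v₁ ⋯ v_k)` (without the unimodular factor `i`), as a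
function of the ingoing frequencies. -/
def zkMultiplier {k d : ℕ} (hd : 0 < d) (x : Config k d) : ℝ :=
  (∑ j : Fin k, x j.succ) ⟨0, hd⟩

end FlexFRE

end

/-!
Every region uses a set `A = {0, p}` of two frequencies, with complement `{a, q}`, where
`{a, p, q}` are the ingoing indices. With the other two frequencies frozen, `v = x_a + x_q` is
fixed, and the phase `L(y) + L(v - y)`, `y = x_q`, is a quadratic polynomial in `y`, because the
cubic terms of `L(ξ) = ξ¹ |ξ|²` cancel. As `L` is odd, the pair `{0, p}` has the same phase, with
`v = x_0 - x_p` and `y = - x_p`. Two estimates for this phase carry the proof.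

* If one frequency of the pair, of size `N`, dominates the other, then the first derivative of the
  phase has size `N²`, since `|ξ|² ≤ ∂₁L(ξ) ≤ 3|ξ|²`. Integration in the first coordinate gains
  `M / N²`, and the weight `⟨y⟩^{-2s'}` (with `s'` as below) is integrated over the other `d - 1`
  coordinates (`lintegral_pairPhase_transversal`).
* If `|v|` has the size `N` of the frequencies, then the phase is, around `v/2`, the quadratic
  form `v¹ |p|² + 2 p¹ ⟪v, p⟫`. Its eigenvalues are `2v¹ ± |v|` and, as `d ≥ 3`, `v¹`; so two of
  them have size at least `|v|/4` (`exists_orthonormal_eigenvectors`), and a form of rank two has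
  sublevel sets of the critical size up to a logarithm (`volume_hessForm_sublevel_le`).

Each is used interpolated with the trivial bound. This turns `M` into `M^{1-θ}` and costs
`N^{3θ}`, which is paid by the distance of `ε` from `2s - d + 2`. For `s` far above the critical
regularity, the excess is used only to bound `⟨ξ⟩` by `⟨ξ_a⟩`, and the argument runs with an
auxiliary `s' ≤ s`, for which `2s' - d + 2 < 1`; here `ε < 1` is needed.

Let `x_a` be the largest ingoing frequency. If it dominates both others, both pairs are of the
first kind (with `x_q` the smallest frequency); if only `x_a` and `x_p` are large, the pair
`{a, q}` is of the first and `{0, p}` of the second kind. If all three are comparable, some choice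
of indices makes both pairs of the second kind, except where for each `p` one of `x_0 - x_p` and
`x_a + x_q` is small (`comparable_cover`). This leaves neighbourhoods of `(ξ, ξ, ξ, ξ)`, with
`σ ≈ 2ξ`, and of `(ξ, ξ, -ξ, -ξ)` up to order, with `σ ≈ -2ξ`. These are the avoided
configurations, on which the domain of integration is empty (`notMem_avoid`). When all frequencies
are bounded there is nothing to prove.
-/

noncomputable section

namespace FlexFRE

open scoped RealInnerProductSpace

/-! ### Sublevel sets of quadratic polynomials and integrals of power weights -/

/-- A quadratic polynomial stays within distance `M` of a value, at points where its derivative is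
at least `l` in size, only on a set of measure `4M/l`: on each of the two rays where the derivative
has size at least `l` the polynomial is strictly monotone, with slope at least `l`. -/
theorem volume_quadratic_sublevel_le (a b c : ℝ) {M l : ℝ} (hM : 0 < M) (hl : 0 ≤ l) :
    volume {t : ℝ | |a * t ^ 2 + b * t + c| < M ∧ l ≤ |2 * a * t + b|}
      ≤ ENNReal.ofReal (4 * M) / ENNReal.ofReal l := by
  rcases hl.eq_or_lt with rfl | hl
  · rw [ENNReal.ofReal_zero, ENNReal.div_zero (by simpa using hM)]
    exact le_top
  have key : ∀ a b c : ℝ, volume {t : ℝ | |a * t ^ 2 + b * t + c| < M ∧ l ≤ 2 * a * t + b}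
      ≤ ENNReal.ofReal (2 * M / l) := by
    intro a b c
    refine (Real.volume_le_diam _).trans (Metric.ediam_le fun x hx y hy => ?_)
    rw [edist_dist, Real.dist_eq]
    refine ENNReal.ofReal_le_ofReal ?_
    obtain ⟨hx1, hx2⟩ := hx
    obtain ⟨hy1, hy2⟩ := hy
    rw [abs_lt] at hx1 hy1
    rw [le_div_iff₀ hl]
    have hid : (x - y) * (((2 * a * x + b) + (2 * a * y + b)) / 2)
        = (a * x ^ 2 + b * x + c) - (a * y ^ 2 + b * y + c) := by ring
    calc |x - y| * l ≤ |x - y| * |((2 * a * x + b) + (2 * a * y + b)) / 2| := by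
          gcongr
          exact le_trans (by linarith) (le_abs_self _)
      _ = |(a * x ^ 2 + b * x + c) - (a * y ^ 2 + b * y + c)| := by rw [← abs_mul, hid]
      _ ≤ 2 * M := by rw [abs_le]; constructor <;> linarith
  have hsub : {t : ℝ | |a * t ^ 2 + b * t + c| < M ∧ l ≤ |2 * a * t + b|} ⊆
      {t : ℝ | |a * t ^ 2 + b * t + c| < M ∧ l ≤ 2 * a * t + b} ∪
      {t : ℝ | |(-a) * t ^ 2 + (-b) * t + (-c)| < M ∧ l ≤ 2 * (-a) * t + (-b)} := by
    rintro t ⟨h1, h2⟩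
    rcases le_abs.1 h2 with h | h
    · exact Or.inl ⟨h1, h⟩
    · refine Or.inr ⟨?_, by linarith⟩
      rw [show (-a) * t ^ 2 + (-b) * t + (-c) = -(a * t ^ 2 + b * t + c) by ring, abs_neg]
      exact h1
  refine (measure_mono hsub).trans ((measure_union_le _ _).trans ?_)
  refine (add_le_add (key a b c) (key _ _ _)).trans ?_
  rw [← ENNReal.ofReal_add (by positivity) (by positivity), ← ENNReal.ofReal_div_of_pos hl]
  exact ENNReal.ofReal_le_ofReal (by rw [← add_div]; gcongr; linarith)

theorem ennreal_le_rpow_mul_rpow {μ X Y : ℝ≥0∞} {θ : ℝ} (h0 : 0 ≤ θ) (h1 : θ ≤ 1) (hX : μ ≤ X)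
    (hY : μ ≤ Y) : μ ≤ X ^ θ * Y ^ (1 - θ) := by
  calc μ = μ ^ (θ + (1 - θ)) := by simp
    _ = μ ^ θ * μ ^ (1 - θ) := ENNReal.rpow_add_of_nonneg _ _ h0 (by linarith)
    _ ≤ _ := mul_le_mul' (ENNReal.rpow_le_rpow hX h0) (ENNReal.rpow_le_rpow hY (by linarith))

/-- The bound of `volume_quadratic_sublevel_le`, interpolated with the trivial bound in an interval
of length `2r`. -/
theorem volume_quadratic_sublevel_interp (a b c : ℝ) {M l r θ : ℝ} (hM : 0 < M) (hl : 0 ≤ l)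
    (h0 : 0 ≤ θ) (h1 : θ ≤ 1) :
    volume {t : ℝ | |t| ≤ r ∧ |a * t ^ 2 + b * t + c| < M ∧ l ≤ |2 * a * t + b|}
      ≤ ENNReal.ofReal (2 * r) ^ θ * (ENNReal.ofReal (4 * M) / ENNReal.ofReal l) ^ (1 - θ) := by
  refine ennreal_le_rpow_mul_rpow h0 h1 ?_
    ((measure_mono fun t ht => ht.2).trans (volume_quadratic_sublevel_le a b c hM hl))
  calc _ ≤ volume (Set.Icc (-r) r) := measure_mono fun t ht => abs_le.1 ht.1
    _ = _ := by rw [Real.volume_Icc]; congr 1; ring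

/-- The weight `|t|^{-b}` on `[-r, r]`, with value `⊤` at `t = 0` for `b > 0`. -/
def cutPow (b r t : ℝ) : ℝ≥0∞ :=
  Set.indicator {t : ℝ | |t| ≤ r} (fun t => ENNReal.ofReal |t| ^ (-b)) t

theorem measurable_cutPow (b r : ℝ) : Measurable (cutPow b r) := by
  refine Measurable.indicator ?_ ?_
  · exact (ENNReal.measurable_ofReal.comp measurable_norm).pow_const _
  · exact measurableSet_le measurable_norm measurable_const

theorem lintegral_cutPow_le {b r : ℝ} (hb1 : b < 1) (hr : 0 < r) :
    ∫⁻ t, cutPow b r t ≤ ENNReal.ofReal (2 * r ^ (1 - b) / (1 - b)) := by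
  have hhalf : ∫⁻ t in Set.Ioc 0 r, ENNReal.ofReal |t| ^ (-b)
      = ENNReal.ofReal (r ^ (1 - b) / (1 - b)) := by
    have hint : IntervalIntegrable (fun t : ℝ => t ^ (-b)) volume 0 r :=
      intervalIntegral.intervalIntegrable_rpow' (by linarith)
    have h2 : ∫ t in Set.Ioc 0 r, t ^ (-b) = r ^ (1 - b) / (1 - b) := by
      rw [← intervalIntegral.integral_of_le hr.le, integral_rpow (Or.inl (by linarith)),
        show -b + 1 = 1 - b by ring, Real.zero_rpow (by linarith), sub_zero]
    rw [← h2, ofReal_integral_eq_lintegral_ofReal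
      ((intervalIntegrable_iff_integrableOn_Ioc_of_le hr.le).1 hint)]
    · refine setLIntegral_congr_fun measurableSet_Ioc fun t ht => ?_
      rw [abs_of_pos ht.1, ENNReal.ofReal_rpow_of_pos ht.1]
    · filter_upwards [ae_restrict_mem measurableSet_Ioc] with t ht
      exact Real.rpow_nonneg ht.1.le _
  have hneg : ∫⁻ t in Set.Ico (-r) 0, ENNReal.ofReal |t| ^ (-b)
      = ENNReal.ofReal (r ^ (1 - b) / (1 - b)) := by
    rw [← hhalf, ← lintegral_indicator measurableSet_Ico, ← lintegral_indicator measurableSet_Ioc,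
      ← lintegral_neg_eq_self]
    refine lintegral_congr fun t => ?_
    by_cases ht : t ∈ Set.Ioc 0 r
    · have : -t ∈ Set.Ico (-r) 0 := ⟨neg_le_neg ht.2, neg_lt_zero.2 ht.1⟩
      rw [Set.indicator_of_mem ht, Set.indicator_of_mem this, abs_neg]
    · have : -t ∉ Set.Ico (-r) 0 := fun h => ht ⟨neg_lt_zero.1 h.2, neg_le_neg_iff.1 h.1⟩
      rw [Set.indicator_of_notMem ht, Set.indicator_of_notMem this]
  have hcov : ({t : ℝ | |t| ≤ r} : Set ℝ) ⊆ (Set.Ico (-r) 0 ∪ Set.Ioc 0 r) ∪ {0} := by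
    intro t ht
    have := abs_le.1 (show |t| ≤ r from ht)
    rcases lt_trichotomy t 0 with h | h | h
    · exact Or.inl (Or.inl ⟨this.1, h⟩)
    · exact Or.inr h
    · exact Or.inl (Or.inr ⟨h, this.2⟩)
  have hms : MeasurableSet {t : ℝ | |t| ≤ r} := measurableSet_le measurable_norm measurable_const
  calc ∫⁻ t, cutPow b r t = ∫⁻ t in {t : ℝ | |t| ≤ r}, ENNReal.ofReal |t| ^ (-b) := by
        rw [← lintegral_indicator hms]; rfl
    _ ≤ ∫⁻ t in (Set.Ico (-r) 0 ∪ Set.Ioc 0 r) ∪ {0}, ENNReal.ofReal |t| ^ (-b) :=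
        lintegral_mono_set hcov
    _ ≤ (∫⁻ t in Set.Ico (-r) 0, ENNReal.ofReal |t| ^ (-b)) +
        (∫⁻ t in Set.Ioc 0 r, ENNReal.ofReal |t| ^ (-b)) + 0 := by
        refine (lintegral_union_le _ _ _).trans (add_le_add (lintegral_union_le _ _ _) ?_)
        rw [setLIntegral_measure_zero _ _ (by simp)]
    _ = _ := by
        have : 0 ≤ r ^ (1 - b) / (1 - b) := div_nonneg (Real.rpow_nonneg hr.le _) (by linarith)
        rw [hneg, hhalf, add_zero, ← ENNReal.ofReal_add this this]
        congr 1; ring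

theorem lintegral_fin_cons_le {m : ℕ} (F : (Fin (m + 1) → ℝ) → ℝ≥0∞) :
    ∫⁻ x, F x ≤ ∫⁻ x' : Fin m → ℝ, ∫⁻ t : ℝ, F (Fin.cons t x' : Fin (m + 1) → ℝ) := by
  have h := (volume_preserving_piFinSuccAbove (fun _ : Fin (m + 1) => ℝ) 0).symm
  rw [← h.lintegral_comp_emb (MeasurableEquiv.measurableEmbedding _),
    Measure.volume_eq_prod, ← lintegral_prod_swap]
  refine (lintegral_prod_le _).trans_eq ?_
  refine lintegral_congr fun x' => lintegral_congr fun t => ?_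
  simp [MeasurableEquiv.piFinSuccAbove, Fin.insertNthEquiv, Fin.insertNth_zero', Prod.swap]

theorem lintegral_prod_coord_le : ∀ {m : ℕ} (h : Fin m → ℝ → ℝ≥0∞), (∀ k, Measurable (h k)) →
    ∫⁻ x : Fin m → ℝ, ∏ k, h k (x k) ≤ ∏ k, ∫⁻ t, h k t
  | 0, h, _ => by simp [volume_pi]
  | m + 1, h, hm => by
    refine (lintegral_fin_cons_le _).trans ?_
    simp only [Fin.prod_univ_succ, Fin.cons_zero, Fin.cons_succ]
    have hmeas : Measurable fun x' : Fin m → ℝ => ∏ k : Fin m, h k.succ (x' k) :=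
      Finset.measurable_fun_prod _ fun k _ => (hm k.succ).comp (measurable_pi_apply k)
    calc _ = ∫⁻ x' : Fin m → ℝ, (∫⁻ t, h 0 t) * ∏ k : Fin m, h k.succ (x' k) :=
          lintegral_congr fun x' => lintegral_mul_const _ (hm 0)
      _ = (∫⁻ t, h 0 t) * ∫⁻ x' : Fin m → ℝ, ∏ k : Fin m, h k.succ (x' k) :=
          lintegral_const_mul _ hmeas
      _ ≤ _ := by
          gcongr
          exact lintegral_prod_coord_le _ fun k => hm k.succ

/-- Integration over the first coordinate, followed by integration of a product of power weights in
the others. -/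
theorem lintegral_le_of_slice_le {m : ℕ} {β : Fin m → ℝ} (hβ : ∀ k, β k < 1) {r : ℝ} (hr : 0 < r)
    (F : (Fin (m + 1) → ℝ) → ℝ≥0∞) (A : ℝ≥0∞)
    (hF : ∀ x' : Fin m → ℝ, ∫⁻ t, F (Fin.cons t x' : Fin (m + 1) → ℝ)
      ≤ A * ∏ k, cutPow (β k) r (x' k)) :
    ∫⁻ x, F x ≤ A * ∏ k, ENNReal.ofReal (2 * r ^ (1 - β k) / (1 - β k)) := by
  have hmeas : Measurable fun x' : Fin m → ℝ => ∏ k : Fin m, cutPow (β k) r (x' k) :=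
    Finset.measurable_fun_prod _ fun k _ => (measurable_cutPow _ _).comp (measurable_pi_apply k)
  calc ∫⁻ x, F x ≤ _ := lintegral_fin_cons_le F
    _ ≤ ∫⁻ x' : Fin m → ℝ, A * ∏ k, cutPow (β k) r (x' k) := lintegral_mono hF
    _ = A * ∫⁻ x' : Fin m → ℝ, ∏ k, cutPow (β k) r (x' k) := lintegral_const_mul _ hmeas
    _ ≤ _ := by
        gcongr
        refine (lintegral_prod_coord_le _ fun k => measurable_cutPow _ _).trans ?_
        exact Finset.prod_le_prod' fun k _ => lintegral_cutPow_le (hβ k) hr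

/-! ### The phase of a pair of frequencies -/

/-- The phase `L(y) + L(v - y)` of a pair of frequencies with prescribed sum `v`, for the
Zakharov–Kuznetsov symbol `L`. The cubic terms in `y` cancel, so this is a quadratic polynomial. -/
def pairPhase {m : ℕ} (v y : Freq (m + 1)) : ℝ :=
  y 0 * ‖y‖ ^ 2 + (v - y) 0 * ‖v - y‖ ^ 2

theorem norm_sq_eq_succ {m : ℕ} (y : Freq (m + 1)) :
    ‖y‖ ^ 2 = y 0 ^ 2 + ∑ k : Fin m, y k.succ ^ 2 := by
  rw [EuclideanSpace.norm_sq_eq, Fin.sum_univ_succ]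
  simp

theorem abs_coord_le_norm {m : ℕ} (y : Freq m) (k : Fin m) : |y k| ≤ ‖y‖ := by
  simpa using PiLp.norm_apply_le y k

theorem one_le_jap {d : ℕ} (y : Freq d) : 1 ≤ jap y := by
  rw [jap, Real.one_le_sqrt]
  nlinarith [sq_nonneg ‖y‖]

theorem jap_pos {d : ℕ} (y : Freq d) : 0 < jap y := one_pos.trans_le (one_le_jap y)

theorem norm_le_jap {d : ℕ} (y : Freq d) : ‖y‖ ≤ jap y :=
  Real.le_sqrt_of_sq_le (by linarith)

theorem jap_le_one_add_norm {d : ℕ} (y : Freq d) : jap y ≤ 1 + ‖y‖ :=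
  Real.sqrt_le_iff.2 ⟨by positivity, by nlinarith [norm_nonneg y]⟩

theorem jap_neg {d : ℕ} (y : Freq d) : jap (-y) = jap y := by simp [jap]

/-- Frequency-restricted estimate in the region where one frequency of the pair dominates: there the
derivative of the phase in the first coordinate has the size of the square of the large frequency,
because `|ξ|² ≤ ∂₁L(ξ) ≤ 3|ξ|²`. -/
theorem lintegral_pairPhase_transversal {m : ℕ} {b θ Q N M : ℝ} (hb0 : 0 ≤ b) (hb : b < 1)
    (hθ0 : 0 ≤ θ) (hθ1 : θ ≤ 1) (hQ : 0 < Q) (hN : 0 < N) (hM : 0 < M) (v : Freq (m + 1)) (α : ℝ) :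
    ∫⁻ y : Freq (m + 1), Set.indicator {y | (N ≤ Q * ‖v - y‖ ∧ ‖v - y‖ ≤ Q * N ∧
        4 * ‖y‖ ≤ ‖v - y‖) ∧ |pairPhase v y - α| < M}
        (fun y => ENNReal.ofReal (jap y ^ (-(m * b)))) y
      ≤ ENNReal.ofReal (2 * (Q * N)) ^ θ *
          (ENNReal.ofReal (4 * M) / ENNReal.ofReal (N ^ 2 / (2 * Q ^ 2))) ^ (1 - θ) *
        ∏ _k : Fin m, ENNReal.ofReal (2 * (Q * N) ^ (1 - b) / (1 - b)) := by
  rw [← (PiLp.volume_preserving_toLp (Fin (m + 1))).lintegral_comp_emb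
    (MeasurableEquiv.toLp 2 (Fin (m + 1) → ℝ)).measurableEmbedding]
  refine lintegral_le_of_slice_le (fun _ => hb) (by positivity) _ _ fun x' => ?_
  set B₁ : ℝ := ∑ k : Fin m, x' k ^ 2 with hB₁
  set B₂ : ℝ := ∑ k : Fin m, (v k.succ - x' k) ^ 2 with hB₂
  set q₂ : ℝ := 3 * v 0
  set q₁ : ℝ := -3 * v 0 ^ 2 + B₁ - B₂
  set q₀ : ℝ := v 0 ^ 3 + v 0 * B₂ - α
  set T : Set ℝ := {t : ℝ | |t| ≤ Q * N ∧ |q₂ * t ^ 2 + q₁ * t + q₀| < M ∧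
    N ^ 2 / (2 * Q ^ 2) ≤ |2 * q₂ * t + q₁|}
  have hpt : ∀ t : ℝ, Set.indicator {y : Freq (m + 1) | (N ≤ Q * ‖v - y‖ ∧ ‖v - y‖ ≤ Q * N ∧
        4 * ‖y‖ ≤ ‖v - y‖) ∧ |pairPhase v y - α| < M}
        (fun y => ENNReal.ofReal (jap y ^ (-(m * b))))
        (WithLp.toLp 2 (Fin.cons t x' : Fin (m + 1) → ℝ))
      ≤ Set.indicator T (fun _ => ∏ k, cutPow b (Q * N) (x' k)) t := by
    intro t
    set y : Freq (m + 1) := WithLp.toLp 2 (Fin.cons t x' : Fin (m + 1) → ℝ) with hy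
    have hy0 : y 0 = t := rfl
    have hyk : ∀ k : Fin m, y k.succ = x' k := fun k => rfl
    have hn1 : ‖y‖ ^ 2 = t ^ 2 + B₁ := by simp [norm_sq_eq_succ, hy0, hyk, hB₁]
    have hn2 : ‖v - y‖ ^ 2 = (v 0 - t) ^ 2 + B₂ := by simp [norm_sq_eq_succ, hy0, hyk, hB₂]
    refine Set.indicator_apply_le' ?_ (fun _ => zero_le)
    rintro ⟨⟨h1, h2, h3⟩, h4⟩
    have hyr : ‖y‖ ≤ Q * N := by linarith [norm_nonneg y]
    have hTt : t ∈ T := by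
      refine ⟨hy0 ▸ (abs_coord_le_norm y 0).trans hyr, ?_, ?_⟩
      · convert h4 using 2
        simp only [pairPhase, hn1, hn2, PiLp.sub_apply, hy0, q₂, q₁, q₀]
        ring
      · -- The derivative is `∂₁L(y) - ∂₁L(v - y)`, where `∂₁L(ξ) = 3(ξ¹)² + (|ξ|² - (ξ¹)²)`.
        have hB : 0 ≤ B₁ := Finset.sum_nonneg fun k _ => sq_nonneg _
        have e : -(2 * q₂ * t + q₁) = 3 * (v 0 - t) ^ 2 + B₂ - (3 * t ^ 2 + B₁) := by
          simp only [q₂, q₁]; ring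
        have h5 : N ^ 2 / (2 * Q ^ 2) ≤ ‖v - y‖ ^ 2 / 2 := by
          rw [div_le_div_iff₀ (by positivity) (by positivity)]
          have := pow_le_pow_left₀ hN.le h1 2
          nlinarith
        have h6 : 16 * ‖y‖ ^ 2 ≤ ‖v - y‖ ^ 2 := by
          have := pow_le_pow_left₀ (by positivity) h3 2
          nlinarith
        rw [← abs_neg, e]
        refine le_trans ?_ (le_abs_self _)
        nlinarith [sq_nonneg t, sq_nonneg (v 0 - t)]
    rw [Set.indicator_of_mem hTt]
    -- The weight is at most a product of powers of the coordinates other than the first.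
    have e1 : ENNReal.ofReal (jap y ^ (-(m * b))) = ∏ _k : Fin m, ENNReal.ofReal (jap y) ^ (-b) := by
      rw [Finset.prod_const, Finset.card_univ, Fintype.card_fin,
        ENNReal.ofReal_rpow_of_pos (jap_pos y), ← ENNReal.ofReal_pow (by
          have := jap_pos y; positivity), ← Real.rpow_natCast, ← Real.rpow_mul (jap_pos y).le]
      congr 2; ring
    rw [e1]
    refine Finset.prod_le_prod' fun k _ => ?_
    have hk : |x' k| ≤ ‖y‖ := hyk k ▸ abs_coord_le_norm y k.succ
    rw [cutPow, Set.indicator_of_mem (show x' k ∈ {t : ℝ | |t| ≤ Q * N} from hk.trans hyr)]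
    rw [ENNReal.rpow_neg, ENNReal.rpow_neg]
    exact ENNReal.inv_le_inv.2 (ENNReal.rpow_le_rpow
      (ENNReal.ofReal_le_ofReal (hk.trans (norm_le_jap y))) hb0)
  refine (lintegral_mono hpt).trans ((lintegral_indicator_const_le _ _).trans ?_)
  rw [mul_comm]
  gcongr
  exact volume_quadratic_sublevel_interp _ _ _ hM (by positivity) hθ0 hθ1

section QuadraticForm

variable {E : Type*} [NormedAddCommGroup E] [InnerProductSpace ℝ E]

/-- The symmetric operator of the quadratic form `p ↦ ⟪e, v⟫ |p|² + 2 ⟪e, p⟫ ⟪v, p⟫`, which is half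
the second derivative at `v` of the Zakharov–Kuznetsov symbol `⟪e, ξ⟫ |ξ|²`. -/
def hessOp (e v p : E) : E := ⟪e, v⟫ • p + ⟪v, p⟫ • e + ⟪e, p⟫ • v

/-- The quadratic form of `hessOp e v`. -/
def hessForm (e v p : E) : ℝ := ⟪e, v⟫ * ‖p‖ ^ 2 + 2 * ⟪e, p⟫ * ⟪v, p⟫

theorem hessForm_add_smul {e v u : E} {l : ℝ} (hu : hessOp e v u = l • u) (hu1 : ‖u‖ = 1) {p : E}
    (hp : ⟪u, p⟫ = 0) (t : ℝ) : hessForm e v (t • u + p) = l * t ^ 2 + hessForm e v p := by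
  have h1 : ⟪hessOp e v u, p⟫ = 0 := by rw [hu, real_inner_smul_left, hp, mul_zero]
  have h2 : ⟪hessOp e v u, u⟫ = l := by
    rw [hu, real_inner_smul_left, real_inner_self_eq_norm_sq, hu1]; ring
  simp only [hessOp, inner_add_left, real_inner_smul_left, hp, mul_zero, zero_add,
    real_inner_self_eq_norm_sq, hu1] at h1 h2
  have h3 : ‖t • u + p‖ ^ 2 = t ^ 2 + ‖p‖ ^ 2 := by
    rw [norm_add_sq_real, norm_smul, hu1, real_inner_smul_left, hp, mul_pow, Real.norm_eq_abs,
      sq_abs]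
    ring
  simp only [hessForm, h3, inner_add_right, real_inner_smul_right]
  linear_combination t ^ 2 * h2 + 2 * t * h1

/-- In dimension at least three, `hessOp e v` has two orthogonal eigenvectors whose eigenvalues are
comparable with `|v|`. The eigenvectors in the plane of `e` and `v` are `|v| e ± v`, with eigenvalues
`2⟪e, v⟫ ± |v|`; every vector orthogonal to this plane has the eigenvalue `⟪e, v⟫`. At most one of
the three eigenvalues can be small. -/
theorem exists_orthogonal_eigenvectors {e v : E} (he : ‖e‖ = 1) (hv : v ≠ 0)
    (hperp : ∃ u : E, u ≠ 0 ∧ ⟪e, u⟫ = 0 ∧ ⟪v, u⟫ = 0) :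
    ∃ (u₀ u₁ : E) (l₀ l₁ : ℝ), u₀ ≠ 0 ∧ u₁ ≠ 0 ∧ ⟪u₀, u₁⟫ = 0 ∧ hessOp e v u₀ = l₀ • u₀ ∧
      hessOp e v u₁ = l₁ • u₁ ∧ ‖v‖ / 4 ≤ |l₀| ∧ ‖v‖ / 4 ≤ |l₁| := by
  set r := ‖v‖ with hr
  set c := ⟪e, v⟫ with hc
  have hr0 : 0 < r := norm_pos_iff.2 hv
  have hvv : ⟪v, v⟫ = r ^ 2 := real_inner_self_eq_norm_sq v
  have hee : ⟪e, e⟫ = 1 := by rw [real_inner_self_eq_norm_sq, he]; norm_num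
  have hve : ⟪v, e⟫ = c := real_inner_comm _ _
  have hp : hessOp e v (r • e + v) = (2 * c + r) • (r • e + v) := by
    simp only [hessOp, inner_add_right, real_inner_smul_right, hee, hvv, hve, ← hc]
    module
  have hm : hessOp e v (r • e - v) = (2 * c - r) • (r • e - v) := by
    simp only [hessOp, inner_sub_right, real_inner_smul_right, hee, hvv, hve, ← hc]
    module
  have hpn : -r < c → r • e + v ≠ 0 := by
    intro h h0
    have h2 : ⟪e, r • e + v⟫ = r + c := by
      simp only [inner_add_right, real_inner_smul_right, hee, ← hc]; ring
    rw [h0, inner_zero_right] at h2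
    linarith
  have hmn : c < r → r • e - v ≠ 0 := by
    intro h h0
    have h2 : ⟪e, r • e - v⟫ = r - c := by
      simp only [inner_sub_right, real_inner_smul_right, hee, ← hc]; ring
    rw [h0, inner_zero_right] at h2
    linarith
  obtain ⟨u, hu0, heu, hvu⟩ := hperp
  have hu : hessOp e v u = c • u := by simp [hessOp, heu, hvu, ← hc]
  rcases le_or_gt (r / 4) c with h | h
  · refine ⟨r • e + v, u, 2 * c + r, c, hpn (by linarith), hu0, ?_, hp, hu, ?_, ?_⟩
    · simp [inner_add_left, real_inner_smul_left, heu, hvu]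
    · exact le_trans (by linarith) (le_abs_self _)
    · exact le_trans (by linarith) (le_abs_self _)
  rcases le_or_gt c (-(r / 4)) with h' | h'
  · refine ⟨r • e - v, u, 2 * c - r, c, hmn (by linarith), hu0, ?_, hm, hu, ?_, ?_⟩
    · simp [inner_sub_left, real_inner_smul_left, heu, hvu]
    · exact le_trans (by linarith) (neg_le_abs _)
    · exact le_trans (by linarith) (neg_le_abs _)
  · refine ⟨r • e + v, r • e - v, 2 * c + r, 2 * c - r, hpn (by linarith), hmn (by linarith), ?_,
      hp, hm, ?_, ?_⟩
    · simp only [inner_add_left, inner_sub_right, real_inner_smul_left, real_inner_smul_right, hee,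
        hvv, hve, ← hc]
      ring
    · exact le_trans (by linarith) (le_abs_self _)
    · exact le_trans (by linarith) (neg_le_abs _)

theorem exists_orthonormal_eigenvectors {e v : E} (he : ‖e‖ = 1) (hv : v ≠ 0)
    (hperp : ∃ u : E, u ≠ 0 ∧ ⟪e, u⟫ = 0 ∧ ⟪v, u⟫ = 0) :
    ∃ (u₀ u₁ : E) (l₀ l₁ : ℝ), ‖u₀‖ = 1 ∧ ‖u₁‖ = 1 ∧ ⟪u₀, u₁⟫ = 0 ∧ hessOp e v u₀ = l₀ • u₀ ∧
      hessOp e v u₁ = l₁ • u₁ ∧ ‖v‖ / 4 ≤ |l₀| ∧ ‖v‖ / 4 ≤ |l₁| := by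
  obtain ⟨u₀, u₁, l₀, l₁, h0, h1, h01, H0, H1, hl0, hl1⟩ :=
    exists_orthogonal_eigenvectors he hv hperp
  have hs : ∀ (a : ℝ) (u : E), hessOp e v (a • u) = a • hessOp e v u := by
    intro a u
    simp only [hessOp, real_inner_smul_right]
    module
  have hn : ∀ u : E, u ≠ 0 → ‖(‖u‖⁻¹ : ℝ) • u‖ = 1 := fun u hu => by
    rw [norm_smul, norm_inv, norm_norm, inv_mul_cancel₀ (norm_ne_zero_iff.2 hu)]
  refine ⟨(‖u₀‖⁻¹ : ℝ) • u₀, (‖u₁‖⁻¹ : ℝ) • u₁, l₀, l₁, hn u₀ h0, hn u₁ h1, ?_, ?_, ?_, hl0, hl1⟩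
  · rw [real_inner_smul_left, real_inner_smul_right, h01, mul_zero, mul_zero]
  · rw [hs, H0, smul_comm]
  · rw [hs, H1, smul_comm]

end QuadraticForm

theorem exists_perp_pair {n : ℕ} (e v : Freq (n + 3)) :
    ∃ u : Freq (n + 3), u ≠ 0 ∧ ⟪e, u⟫ = 0 ∧ ⟪v, u⟫ = 0 := by
  classical
  set S : Submodule ℝ (Freq (n + 3)) := Submodule.span ℝ (({e, v} : Finset (Freq (n + 3))) : Set _)
  have h1 : Module.finrank ℝ S ≤ 2 := (finrank_span_finset_le_card _).trans Finset.card_le_two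
  have h2 : Module.finrank ℝ S + Module.finrank ℝ Sᗮ = n + 3 := by
    rw [Submodule.finrank_add_finrank_orthogonal, finrank_euclideanSpace, Fintype.card_fin]
  have h3 : Sᗮ ≠ ⊥ := by
    intro h
    rw [h, finrank_bot] at h2
    omega
  obtain ⟨u, hu, hu0⟩ := Submodule.exists_mem_ne_zero_of_ne_bot h3
  rw [Submodule.mem_orthogonal] at hu
  exact ⟨u, hu0, hu e (Submodule.subset_span (by simp)), hu v (Submodule.subset_span (by simp))⟩

/-- Slicing along one eigenvector of the form, in the region where the derivative along it dominates
the derivative along another eigenvector. On each line the derivative is then bounded below by a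
quantity that depends on the other coordinates only, and `|x|^{-(1-θ)}` is integrable in it. -/
theorem volume_hessForm_sublevel_half {n : ℕ} {e v u₀ u₁ : Freq (n + 2)} {l₀ l₁ θ r M : ℝ}
    (hu₀ : ‖u₀‖ = 1) (hu₁ : ‖u₁‖ = 1) (h01 : ⟪u₀, u₁⟫ = 0) (H₀ : hessOp e v u₀ = l₀ • u₀)
    (hθ0 : 0 < θ) (hθ1 : θ ≤ 1) (hr : 0 < r) (hM : 0 < M) (α : ℝ) :
    volume {p : Freq (n + 2) | ‖p‖ ≤ r ∧ |l₁ * ⟪u₁, p⟫| ≤ |l₀ * ⟪u₀, p⟫| ∧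
        |hessForm e v p - α| < M}
      ≤ ENNReal.ofReal (2 * r) ^ θ *
          (ENNReal.ofReal (4 * M) / ENNReal.ofReal (2 * |l₁|)) ^ (1 - θ) *
        (ENNReal.ofReal (2 * r ^ θ / θ) * ENNReal.ofReal (2 * r) ^ n) := by
  obtain ⟨b, hb⟩ := Orthonormal.exists_orthonormalBasis_extension_of_card_eq (𝕜 := ℝ)
    (E := Freq (n + 2)) (ι := Fin (n + 2)) (by simp)
    (v := fun k => if k = 0 then u₀ else u₁) (s := {0, 1}) (by
      rw [orthonormal_iff_ite]
      rintro ⟨i, hi⟩ ⟨j, hj⟩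
      have h10 : ⟪u₁, u₀⟫ = 0 := by rw [real_inner_comm, h01]
      rcases hi with rfl | rfl <;> rcases hj with rfl | rfl <;>
        simp [hu₀, hu₁, h01, h10, Subtype.ext_iff])
  have hb0 : b 0 = u₀ := by simpa using hb 0 (by simp)
  have hb1 : b 1 = u₁ := by simpa using hb 1 (by simp)
  set S : Set (Freq (n + 2)) := {p | ‖p‖ ≤ r ∧ |l₁ * ⟪u₁, p⟫| ≤ |l₀ * ⟪u₀, p⟫| ∧
        |hessForm e v p - α| < M}
  set β : Fin (n + 1) → ℝ := Fin.cons (1 - θ) fun _ => 0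
  have hβ : ∀ k, β k < 1 := by
    intro k
    refine Fin.cases ?_ (fun k => ?_) k
    · simpa [β] using hθ0
    · simp [β]
  have hS : MeasurableSet S := by
    have hc : Continuous (hessForm e v) := by unfold hessForm; fun_prop
    have h1 : MeasurableSet {p : Freq (n + 2) | ‖p‖ ≤ r} :=
      (isClosed_le continuous_norm continuous_const).measurableSet
    have h2 : MeasurableSet {p : Freq (n + 2) | |l₁ * ⟪u₁, p⟫| ≤ |l₀ * ⟪u₀, p⟫|} :=
      (isClosed_le (by fun_prop) (by fun_prop)).measurableSet
    have h3 : MeasurableSet {p : Freq (n + 2) | |hessForm e v p - α| < M} :=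
      (isOpen_lt (by fun_prop) continuous_const).measurableSet
    exact h1.inter (h2.inter h3)
  have hpres : MeasurePreserving (fun x : Fin (n + 2) → ℝ => b.repr.symm (WithLp.toLp 2 x)) :=
    b.repr.symm.measurePreserving.comp (PiLp.volume_preserving_toLp (Fin (n + 2)))
  have hemb : MeasurableEmbedding (fun x : Fin (n + 2) → ℝ => b.repr.symm (WithLp.toLp 2 x)) :=
    b.repr.symm.toMeasurableEquiv.measurableEmbedding.comp
      (MeasurableEquiv.toLp 2 (Fin (n + 2) → ℝ)).measurableEmbedding
  rw [← lintegral_indicator_one hS, ← hpres.lintegral_comp_emb hemb]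
  refine (lintegral_le_of_slice_le hβ hr _ (ENNReal.ofReal (2 * r) ^ θ *
          (ENNReal.ofReal (4 * M) / ENNReal.ofReal (2 * |l₁|)) ^ (1 - θ)) fun x' => ?_).trans_eq ?_
  · set w : Freq (n + 2) := ∑ k : Fin (n + 1), x' k • b k.succ
    have hw : ⟪u₀, w⟫ = 0 := by
      simp only [w, inner_sum, real_inner_smul_right, ← hb0]
      refine Finset.sum_eq_zero fun k _ => ?_
      rw [b.orthonormal.2 (Fin.succ_ne_zero k).symm, mul_zero]
    -- `w ⟂ u₀`, and `u₀` is an eigenvector: the form has no mixed term, so that the phase on the line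
    -- has the derivative `2 l₀ t`, which here is at least `2 |l₁| |x' 0|` in size.
    set T : Set ℝ := {t : ℝ | |t| ≤ r ∧ |l₀ * t ^ 2 + 0 * t + (hessForm e v w - α)| < M ∧
      2 * |l₁| * |x' 0| ≤ |2 * l₀ * t + 0|}
    have hpt : ∀ t : ℝ, S.indicator 1 (b.repr.symm (WithLp.toLp 2 (Fin.cons t x' : Fin (n + 2) → ℝ)))
        ≤ T.indicator (fun _ => ∏ k : Fin n, cutPow 0 r (x' k.succ)) t *
          Set.indicator {x : ℝ | |x| ≤ r} 1 (x' 0) := by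
      intro t
      set p : Freq (n + 2) := b.repr.symm (WithLp.toLp 2 (Fin.cons t x' : Fin (n + 2) → ℝ)) with hp
      have hrp : b.repr p = WithLp.toLp 2 (Fin.cons t x' : Fin (n + 2) → ℝ) := by simp [hp]
      have hin : ∀ k, ⟪b k, p⟫ = (Fin.cons t x' : Fin (n + 2) → ℝ) k := by
        intro k
        rw [← b.repr_apply_apply, hrp]
      have hpe : p = t • u₀ + w := by
        rw [← b.sum_repr p, Fin.sum_univ_succ, hrp, ← hb0]
        simp [w]
      have hle : ∀ k, |⟪b k, p⟫| ≤ ‖p‖ := by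
        intro k
        have := abs_real_inner_le_norm (b k) p
        rwa [b.norm_eq_one, one_mul] at this
      have h0 : ⟪u₀, p⟫ = t := by rw [← hb0, hin]; simp
      have h1 : ⟪u₁, p⟫ = x' 0 := by rw [← hb1, hin]; rfl
      refine Set.indicator_apply_le' ?_ (fun _ => zero_le)
      rintro ⟨hp1, hp2, hp3⟩
      have hk : ∀ k : Fin (n + 1), |x' k| ≤ r := by
        intro k
        have := (hle k.succ).trans hp1
        rwa [hin, Fin.cons_succ] at this
      have hT : t ∈ T := by
        refine ⟨h0 ▸ hb0 ▸ (hle 0).trans hp1, ?_, ?_⟩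
        · rw [hpe, hessForm_add_smul H₀ hu₀ hw] at hp3
          rwa [zero_mul, add_zero, ← add_sub_assoc]
        · rw [h0, h1, abs_mul, abs_mul] at hp2
          rw [add_zero, abs_mul, abs_mul, abs_two]
          linarith
      rw [Set.indicator_of_mem hT, Set.indicator_of_mem (show x' 0 ∈ {x : ℝ | |x| ≤ r} from hk 0)]
      simp only [cutPow]
      rw [Finset.prod_eq_one]
      · simp
      · intro k _
        rw [Set.indicator_of_mem (show x' k.succ ∈ {x : ℝ | |x| ≤ r} from hk _)]
        simp
    refine (lintegral_mono hpt).trans ?_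
    rw [lintegral_mul_const' _ _ (by
      by_cases h : x' 0 ∈ {x : ℝ | |x| ≤ r} <;> simp [h])]
    refine (mul_le_mul_left (lintegral_indicator_const_le _ _) _).trans ?_
    rw [Fin.prod_univ_succ]
    simp only [β, Fin.cons_zero, Fin.cons_succ]
    have hvol : volume T * Set.indicator {x : ℝ | |x| ≤ r} 1 (x' 0) ≤ ENNReal.ofReal (2 * r) ^ θ *
          (ENNReal.ofReal (4 * M) / ENNReal.ofReal (2 * |l₁|)) ^ (1 - θ) *
          cutPow (1 - θ) r (x' 0) := by
      by_cases h : x' 0 ∈ {x : ℝ | |x| ≤ r}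
      · rw [cutPow, Set.indicator_of_mem h, Set.indicator_of_mem h, Pi.one_apply, mul_one]
        refine (volume_quadratic_sublevel_interp l₀ 0 _ hM (by positivity) hθ0.le hθ1).trans_eq ?_
        rw [mul_assoc (ENNReal.ofReal (2 * r) ^ θ), ENNReal.ofReal_mul (p := 2 * |l₁|)
          (by positivity), ENNReal.rpow_neg,
          ← ENNReal.inv_rpow, ← ENNReal.mul_rpow_of_nonneg _ _ (by linarith), div_eq_mul_inv,
          div_eq_mul_inv, ENNReal.mul_inv (Or.inr ENNReal.ofReal_ne_top)
            (Or.inl ENNReal.ofReal_ne_top), mul_assoc]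
      · simp [h]
    calc _ = (volume T * Set.indicator {x : ℝ | |x| ≤ r} 1 (x' 0)) *
          ∏ k : Fin n, cutPow 0 r (x' k.succ) := by ring
      _ ≤ _ := by
          refine (mul_le_mul_left hvol _).trans_eq ?_
          ring
  · rw [Fin.prod_univ_succ]
    simp [β]

/-! ### Estimates for a pair with prescribed sum -/

/-- In dimension at least three the sublevel sets of `hessForm e v` have, up to an arbitrarily small
power, the measure that a nonstationary phase with a derivative of size `r|v|` would give. -/
theorem volume_hessForm_sublevel_le {n : ℕ} {e v : Freq (n + 3)} {θ r M : ℝ} (he : ‖e‖ = 1)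
    (hv : v ≠ 0) (hθ0 : 0 < θ) (hθ1 : θ ≤ 1) (hr : 0 < r) (hM : 0 < M) (α : ℝ) :
    volume {p : Freq (n + 3) | ‖p‖ ≤ r ∧ |hessForm e v p - α| < M}
      ≤ 2 * (ENNReal.ofReal (2 * r) ^ θ *
          (ENNReal.ofReal (4 * M) / ENNReal.ofReal (‖v‖ / 2)) ^ (1 - θ) *
        (ENNReal.ofReal (2 * r ^ θ / θ) * ENNReal.ofReal (2 * r) ^ (n + 1))) := by
  obtain ⟨u₀, u₁, l₀, l₁, h0, h1, h01, H0, H1, hl0, hl1⟩ :=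
    exists_orthonormal_eigenvectors he hv (exists_perp_pair e v)
  have h10 : ⟪u₁, u₀⟫ = 0 := by rw [real_inner_comm, h01]
  have hmono : ∀ l : ℝ, ‖v‖ / 4 ≤ |l| → ENNReal.ofReal (2 * r) ^ θ *
          (ENNReal.ofReal (4 * M) / ENNReal.ofReal (2 * |l|)) ^ (1 - θ) *
        (ENNReal.ofReal (2 * r ^ θ / θ) * ENNReal.ofReal (2 * r) ^ (n + 1)) ≤
        ENNReal.ofReal (2 * r) ^ θ *
          (ENNReal.ofReal (4 * M) / ENNReal.ofReal (‖v‖ / 2)) ^ (1 - θ) *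
        (ENNReal.ofReal (2 * r ^ θ / θ) * ENNReal.ofReal (2 * r) ^ (n + 1)) := by
    intro l hl
    gcongr
    linarith
  rw [two_mul]
  refine (measure_mono ?_).trans ((measure_union_le _ _).trans (add_le_add
    ((volume_hessForm_sublevel_half h0 h1 h01 H0 hθ0 hθ1 hr hM α).trans (hmono l₁ hl1))
    ((volume_hessForm_sublevel_half h1 h0 h10 H1 hθ0 hθ1 hr hM α).trans (hmono l₀ hl0))))
  rintro p ⟨hp1, hp2⟩
  rcases le_total |l₁ * ⟪u₁, p⟫| |l₀ * ⟪u₀, p⟫| with h | h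
  · exact Or.inl ⟨hp1, h, hp2⟩
  · exact Or.inr ⟨hp1, h, hp2⟩

/-- Around the midpoint `v/2` the phase of a pair with sum `v` is a pure quadratic form. -/
theorem pairPhase_eq_hessForm {m : ℕ} (v y : Freq (m + 1)) :
    pairPhase v y = v 0 * ‖v‖ ^ 2 / 4 +
      hessForm (EuclideanSpace.single 0 1) v (y - (1 / 2 : ℝ) • v) := by
  have h1 : ∀ p : Freq (m + 1), ⟪(EuclideanSpace.single 0 1 : Freq (m + 1)), p⟫ = p 0 := by
    intro p; simp [EuclideanSpace.inner_single_left]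
  have h2 : ‖y - (1 / 2 : ℝ) • v‖ ^ 2 = ‖y‖ ^ 2 - ⟪v, y⟫ + ‖v‖ ^ 2 / 4 := by
    rw [norm_sub_sq_real, norm_smul, real_inner_smul_right, real_inner_comm]
    norm_num
    ring
  have h3 : ‖v - y‖ ^ 2 = ‖v‖ ^ 2 - 2 * ⟪v, y⟫ + ‖y‖ ^ 2 := norm_sub_sq_real _ _
  simp only [pairPhase, hessForm, h1, h2, h3, inner_sub_right, real_inner_smul_right,
    real_inner_self_eq_norm_sq, PiLp.sub_apply, PiLp.smul_apply, smul_eq_mul]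
  ring

theorem continuous_pairPhase {m : ℕ} (v : Freq (m + 1)) : Continuous (pairPhase v) := by
  unfold pairPhase; fun_prop

theorem volume_pairPhase_sublevel_le {n : ℕ} {v : Freq (n + 3)} {θ r M : ℝ}
    (hv : v ≠ 0) (hθ0 : 0 < θ) (hθ1 : θ ≤ 1) (hr : 0 < r) (hvr : ‖v‖ ≤ r) (hM : 0 < M) (α : ℝ) :
    volume {y : Freq (n + 3) | ‖y‖ ≤ r ∧ |pairPhase v y - α| < M}
      ≤ 2 * (ENNReal.ofReal (2 * (2 * r)) ^ θ *
          (ENNReal.ofReal (4 * M) / ENNReal.ofReal (‖v‖ / 2)) ^ (1 - θ) *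
        (ENNReal.ofReal (2 * (2 * r) ^ θ / θ) * ENNReal.ofReal (2 * (2 * r)) ^ (n + 1))) := by
  refine le_trans ?_ (volume_hessForm_sublevel_le
    (e := (EuclideanSpace.single 0 1 : Freq (n + 3))) (by simp) hv hθ0 hθ1
    (by positivity : 0 < 2 * r) hM (α - v 0 * ‖v‖ ^ 2 / 4))
  refine le_trans ?_ (measure_preimage_add_right volume (-((1 / 2 : ℝ) • v)) _).le
  refine measure_mono ?_
  rintro y ⟨hy1, hy2⟩
  refine ⟨?_, ?_⟩
  · change ‖y + -((1 / 2 : ℝ) • v)‖ ≤ 2 * r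
    refine (norm_add_le _ _).trans ?_
    rw [norm_neg, norm_smul, Real.norm_of_nonneg (by norm_num)]
    linarith [norm_nonneg v]
  · change |hessForm _ v (y + -((1 / 2 : ℝ) • v)) - _| < M
    rw [pairPhase_eq_hessForm] at hy2
    rw [← sub_eq_add_neg]
    convert hy2 using 2
    ring

/-- The three regions for the variable frequency `y` of a pair with sum `v`, at the frequency scale
`N`, up to a factor `Q`: `v - y` has size `N` and dominates `y`; or `y` and `v` have size `N`; or all
frequencies are bounded. -/
def PairRegion {d : ℕ} (Q N : ℝ) (v y : Freq d) : Prop :=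
  (N ≤ Q * ‖v - y‖ ∧ ‖v - y‖ ≤ Q * N ∧ 4 * ‖y‖ ≤ ‖v - y‖) ∨
    (N ≤ Q * ‖y‖ ∧ ‖y‖ ≤ Q * N ∧ N ≤ Q * ‖v‖ ∧ ‖v‖ ≤ Q * N) ∨ (N ≤ Q ∧ ‖y‖ ≤ Q)

/-- The weight `⟨y⟩^{-2s}` is integrated over the `n + 2` coordinates other than the first. By the
relation `hse` between the exponents, the power of `N` in the bound is zero. -/
theorem setLIntegral_transversal_le {n : ℕ} {s e θ Q : ℝ} (hs0 : 0 ≤ s) (hθ0 : 0 < θ)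
    (hθ1 : θ ≤ 1) (hsn : 2 * s < n + 2) (hse : 2 * s = n + 1 + e + 3 * θ) (hQ : 0 < Q) :
    ∃ C : ℝ, ∀ (N M α : ℝ) (v : Freq (n + 3)), 1 ≤ N → 1 ≤ M →
      ∫⁻ y in {y | (N ≤ Q * ‖v - y‖ ∧ ‖v - y‖ ≤ Q * N ∧ 4 * ‖y‖ ≤ ‖v - y‖) ∧
        |pairPhase v y - α| < M}, ENNReal.ofReal (N ^ (1 + e) * jap y ^ (-(2 * s)))
      ≤ ENNReal.ofReal (C * M ^ (1 - θ)) := by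
  set b : ℝ := 2 * s / (n + 2) with hb
  have hn : (0 : ℝ) < n + 2 := by positivity
  have hb0 : 0 ≤ b := by positivity
  have hb1 : b < 1 := (div_lt_one hn).2 hsn
  have hbs : ((n + 2 : ℕ) : ℝ) * b = 2 * s := by rw [hb]; push_cast; field_simp
  have h1b : 0 < 1 - b := by linarith
  refine ⟨(2 * Q) ^ θ * (8 * Q ^ 2) ^ (1 - θ) * (2 * Q ^ (1 - b) / (1 - b)) ^ (n + 2),
    fun N M α v hN1 hM1 => ?_⟩
  have hN : 0 < N := by linarith
  have hM : 0 < M := by linarith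
  have hms : MeasurableSet {y : Freq (n + 3) | (N ≤ Q * ‖v - y‖ ∧ ‖v - y‖ ≤ Q * N ∧
      4 * ‖y‖ ≤ ‖v - y‖) ∧ |pairPhase v y - α| < M} := by
    have := continuous_pairPhase v
    refine MeasurableSet.inter (MeasurableSet.inter ?_ (MeasurableSet.inter ?_ ?_)) ?_
    · exact (isClosed_le (f := fun _ : Freq (n + 3) => N) (g := fun y => Q * ‖v - y‖)
        (by fun_prop) (by fun_prop)).measurableSet
    · exact (isClosed_le (f := fun y : Freq (n + 3) => ‖v - y‖) (g := fun _ => Q * N)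
        (by fun_prop) (by fun_prop)).measurableSet
    · exact (isClosed_le (f := fun y : Freq (n + 3) => 4 * ‖y‖) (g := fun y => ‖v - y‖)
        (by fun_prop) (by fun_prop)).measurableSet
    · exact (isOpen_lt (f := fun y : Freq (n + 3) => |pairPhase v y - α|) (g := fun _ => M)
        (by fun_prop) (by fun_prop)).measurableSet
  have hmain := lintegral_pairPhase_transversal (m := n + 2) hb0 hb1 hθ0.le hθ1 hQ hN hM v α
  rw [lintegral_indicator hms, hbs] at hmain
  simp_rw [ENNReal.ofReal_mul (Real.rpow_nonneg hN.le (1 + e))]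
  rw [lintegral_const_mul' _ _ ENNReal.ofReal_ne_top]
  refine (mul_le_mul_right hmain _).trans_eq ?_
  have hx : 0 < N ^ 2 / (2 * Q ^ 2) := by positivity
  rw [Finset.prod_const, Finset.card_univ, Fintype.card_fin, ← ENNReal.ofReal_div_of_pos hx,
    ENNReal.ofReal_rpow_of_pos (by positivity), ENNReal.ofReal_rpow_of_pos (by positivity),
    ← ENNReal.ofReal_pow (by positivity), ← ENNReal.ofReal_mul (by positivity),
    ← ENNReal.ofReal_mul (by positivity), ← ENNReal.ofReal_mul (by positivity)]
  congr 1
  have e1 : (2 * (Q * N)) ^ θ = (2 * Q) ^ θ * N ^ θ := by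
    rw [← mul_assoc, Real.mul_rpow (by positivity) hN.le]
  have e2 : (4 * M / (N ^ 2 / (2 * Q ^ 2))) ^ (1 - θ)
      = (8 * Q ^ 2) ^ (1 - θ) * M ^ (1 - θ) * N ^ (-2 * (1 - θ)) := by
    rw [Real.rpow_mul hN.le, ← Real.mul_rpow (by positivity) hM.le,
      ← Real.mul_rpow (by positivity) (by positivity), Real.rpow_neg hN.le, Real.rpow_two]
    congr 1
    field_simp
    norm_num
  have e3 : (2 * (Q * N) ^ (1 - b) / (1 - b)) ^ (n + 2)
      = (2 * Q ^ (1 - b) / (1 - b)) ^ (n + 2) * N ^ ((1 - b) * (n + 2 : ℕ)) := by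
    rw [Real.mul_rpow hQ.le hN.le, Real.rpow_mul hN.le, Real.rpow_natCast, ← mul_pow]
    congr 1
    ring
  have e4 : N ^ (1 + e) * N ^ θ * N ^ (-2 * (1 - θ)) * N ^ ((1 - b) * (n + 2 : ℕ)) = 1 := by
    rw [← Real.rpow_add hN, ← Real.rpow_add hN, ← Real.rpow_add hN]
    convert Real.rpow_zero N using 2
    push_cast at hbs ⊢
    linear_combination -hbs - hse
  rw [e1, e2, e3]
  linear_combination ((2 * Q) ^ θ * (8 * Q ^ 2) ^ (1 - θ) * M ^ (1 - θ) *
    (2 * Q ^ (1 - b) / (1 - b)) ^ (n + 2)) * e4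

/-- The weight is bounded by a power of `N`, and the measure by `volume_pairPhase_sublevel_le`. By the
relation `hse` between the exponents, the power of `N` in the bound is zero. -/
theorem setLIntegral_nondegenerate_le {n : ℕ} {s e θ Q : ℝ} (hs0 : 0 ≤ s) (hθ0 : 0 < θ)
    (hθ1 : θ ≤ 1) (hse : 2 * s = n + 1 + e + 3 * θ) (hQ : 0 < Q) :
    ∃ C : ℝ, ∀ (N M α : ℝ) (v : Freq (n + 3)), 1 ≤ N → 1 ≤ M →
      ∫⁻ y in {y | (N ≤ Q * ‖y‖ ∧ ‖y‖ ≤ Q * N ∧ N ≤ Q * ‖v‖ ∧ ‖v‖ ≤ Q * N) ∧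
        |pairPhase v y - α| < M}, ENNReal.ofReal (N ^ (1 + e) * jap y ^ (-(2 * s)))
      ≤ ENNReal.ofReal (C * M ^ (1 - θ)) := by
  refine ⟨(Q⁻¹) ^ (-(2 * s)) * (2 * ((4 * Q) ^ θ * (8 * Q) ^ (1 - θ) *
    (2 * (2 * Q) ^ θ / θ * (4 * Q) ^ (n + 1)))), fun N M α v hN1 hM1 => ?_⟩
  have hN : 0 < N := by linarith
  have hM : 0 < M := by linarith
  set S := {y : Freq (n + 3) | (N ≤ Q * ‖y‖ ∧ ‖y‖ ≤ Q * N ∧ N ≤ Q * ‖v‖ ∧ ‖v‖ ≤ Q * N) ∧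
        |pairPhase v y - α| < M}
  by_cases hv : N ≤ Q * ‖v‖ ∧ ‖v‖ ≤ Q * N
  swap
  · have : S = ∅ := by
      ext y
      simp only [S, Set.mem_ofPred_eq, Set.mem_empty_iff_false, iff_false]
      rintro ⟨⟨-, -, h⟩, -⟩
      exact hv h
    simp [this]
  obtain ⟨hv1, hv2⟩ := hv
  have hvQ : N / Q ≤ ‖v‖ := by rw [div_le_iff₀ hQ]; linarith
  have hv0 : v ≠ 0 := norm_pos_iff.1 (lt_of_lt_of_le (by positivity) hvQ)
  have hc : ∀ y ∈ S, ENNReal.ofReal (N ^ (1 + e) * jap y ^ (-(2 * s)))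
      ≤ ENNReal.ofReal (N ^ (1 + e) * (N * Q⁻¹) ^ (-(2 * s))) := by
    rintro y ⟨⟨hy, -⟩, -⟩
    have : N * Q⁻¹ ≤ jap y := by
      refine le_trans ?_ (norm_le_jap y)
      rw [← div_eq_mul_inv, div_le_iff₀ hQ]; linarith
    have := Real.rpow_le_rpow_of_nonpos (by positivity) this (by linarith : -(2 * s) ≤ 0)
    gcongr
  have hvol := volume_pairPhase_sublevel_le (r := Q * N) hv0 hθ0 hθ1 (by positivity) hv2 hM α
  have hvol2 : volume S ≤ 2 * (ENNReal.ofReal (2 * (2 * (Q * N))) ^ θ *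
          (ENNReal.ofReal (4 * M) / ENNReal.ofReal (N / Q / 2)) ^ (1 - θ) *
        (ENNReal.ofReal (2 * (2 * (Q * N)) ^ θ / θ) *
          ENNReal.ofReal (2 * (2 * (Q * N))) ^ (n + 1))) := by
    have hsub : S ⊆ {y | ‖y‖ ≤ Q * N ∧ |pairPhase v y - α| < M} := fun y hy => ⟨hy.1.2.1, hy.2⟩
    refine (measure_mono hsub).trans (hvol.trans ?_)
    gcongr
  have hms : MeasurableSet S := by
    have := continuous_pairPhase v
    refine MeasurableSet.inter (MeasurableSet.inter ?_ (MeasurableSet.inter ?_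
      (MeasurableSet.const _))) ?_
    · exact (isClosed_le (f := fun _ : Freq (n + 3) => N) (g := fun y => Q * ‖y‖)
        (by fun_prop) (by fun_prop)).measurableSet
    · exact (isClosed_le (f := fun y : Freq (n + 3) => ‖y‖) (g := fun _ => Q * N)
        (by fun_prop) (by fun_prop)).measurableSet
    · exact (isOpen_lt (f := fun y : Freq (n + 3) => |pairPhase v y - α|) (g := fun _ => M)
        (by fun_prop) (by fun_prop)).measurableSet
  refine (setLIntegral_mono' hms hc).trans ?_
  rw [setLIntegral_const]
  refine (mul_le_mul_right hvol2 _).trans_eq ?_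
  have hx : 0 < N / Q / 2 := by positivity
  rw [← ENNReal.ofReal_div_of_pos hx,
    ENNReal.ofReal_rpow_of_pos (by positivity), ENNReal.ofReal_rpow_of_pos (by positivity),
    ← ENNReal.ofReal_pow (by positivity), ← ENNReal.ofReal_mul (by positivity),
    ← ENNReal.ofReal_mul (by positivity), ← ENNReal.ofReal_mul (by positivity),
    ← ENNReal.ofReal_ofNat 2, ← ENNReal.ofReal_mul (by positivity),
    ← ENNReal.ofReal_mul (by positivity)]
  congr 1
  have e1 : (2 * (2 * (Q * N))) ^ θ = (4 * Q) ^ θ * N ^ θ := by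
    rw [← Real.mul_rpow (by positivity) hN.le]; congr 1; ring
  have e1' : (2 * (Q * N)) ^ θ = (2 * Q) ^ θ * N ^ θ := by
    rw [← mul_assoc, Real.mul_rpow (by positivity) hN.le]
  have e2 : (4 * M / (N / Q / 2)) ^ (1 - θ)
      = (8 * Q) ^ (1 - θ) * M ^ (1 - θ) * N ^ (-1 * (1 - θ)) := by
    rw [Real.rpow_mul hN.le, ← Real.mul_rpow (by positivity) hM.le,
      ← Real.mul_rpow (by positivity) (by positivity), Real.rpow_neg hN.le, Real.rpow_one]
    congr 1
    field_simp
    norm_num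
  have e3 : (2 * (2 * (Q * N))) ^ (n + 1) = (4 * Q) ^ (n + 1) * N ^ ((n : ℝ) + 1) := by
    have : N ^ ((n : ℝ) + 1) = N ^ (n + 1) := by
      rw [← Real.rpow_natCast]; push_cast; rfl
    rw [this, ← mul_pow]; congr 1; ring
  have e5 : (N * Q⁻¹) ^ (-(2 * s)) = N ^ (-(2 * s)) * (Q⁻¹) ^ (-(2 * s)) :=
    Real.mul_rpow hN.le (by positivity)
  have e4 : N ^ (1 + e) * N ^ (-(2 * s)) * N ^ θ * N ^ (-1 * (1 - θ)) * N ^ θ * N ^ ((n : ℝ) + 1)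
      = 1 := by
    rw [← Real.rpow_add hN, ← Real.rpow_add hN, ← Real.rpow_add hN, ← Real.rpow_add hN,
      ← Real.rpow_add hN]
    convert Real.rpow_zero N using 2
    linear_combination - hse
  rw [e1, e1', e2, e3, e5]
  linear_combination ((Q⁻¹) ^ (-(2 * s)) * (2 * ((4 * Q) ^ θ * (8 * Q) ^ (1 - θ) *
    (2 * (2 * Q) ^ θ / θ * (4 * Q) ^ (n + 1)))) * M ^ (1 - θ)) * e4

theorem setLIntegral_bounded_le {d : ℕ} {s e θ Q : ℝ} (hs0 : 0 ≤ s) (he : 0 ≤ e) (hθ1 : θ ≤ 1) :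
    ∃ C : ℝ, ∀ (N M : ℝ) (S : Set (Freq d)), 1 ≤ N → 1 ≤ M → (∀ y ∈ S, N ≤ Q ∧ ‖y‖ ≤ Q) →
      ∫⁻ y in S, ENNReal.ofReal (N ^ (1 + e) * jap y ^ (-(2 * s)))
      ≤ ENNReal.ofReal (C * M ^ (1 - θ)) := by
  refine ⟨Q ^ (1 + e) * (volume (Metric.closedBall (0 : Freq d) Q)).toReal,
    fun N M S hN1 hM1 hS => ?_⟩
  rcases S.eq_empty_or_nonempty with rfl | ⟨y₀, hy₀⟩
  · simp
  have hNQ : N ≤ Q := (hS y₀ hy₀).1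
  have hQ0 : 0 ≤ Q := by linarith
  have hle : ∀ y : Freq d, ENNReal.ofReal (N ^ (1 + e) * jap y ^ (-(2 * s)))
      ≤ ENNReal.ofReal (Q ^ (1 + e)) := by
    intro y
    refine ENNReal.ofReal_le_ofReal ?_
    have h1 : jap y ^ (-(2 * s)) ≤ 1 :=
      Real.rpow_le_one_of_one_le_of_nonpos (one_le_jap y) (by linarith)
    have h2 : N ^ (1 + e) ≤ Q ^ (1 + e) := Real.rpow_le_rpow (by linarith) hNQ (by linarith)
    calc N ^ (1 + e) * jap y ^ (-(2 * s)) ≤ N ^ (1 + e) * 1 := by gcongr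
      _ ≤ _ := by linarith
  refine (lintegral_mono hle).trans ?_
  rw [setLIntegral_const]
  calc _ ≤ ENNReal.ofReal (Q ^ (1 + e)) * volume (Metric.closedBall (0 : Freq d) Q) := by
        gcongr
        intro y hy
        simpa using (hS y hy).2
    _ = ENNReal.ofReal (Q ^ (1 + e) * (volume (Metric.closedBall (0 : Freq d) Q)).toReal) := by
        rw [ENNReal.ofReal_mul (by positivity), ENNReal.ofReal_toReal]
        exact measure_closedBall_lt_top.ne
    _ ≤ _ := by
        refine ENNReal.ofReal_le_ofReal (le_mul_of_one_le_right (by positivity) ?_)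
        exact Real.one_le_rpow hM1 (by linarith)

/-- The frequency-restricted estimate for a pair of frequencies with prescribed sum. -/
theorem lintegral_pairRegion_le {n : ℕ} {s e θ Q : ℝ} (hs0 : 0 ≤ s) (he : 0 ≤ e) (hθ0 : 0 < θ)
    (hθ1 : θ ≤ 1) (hsn : 2 * s < n + 2) (hse : 2 * s = n + 1 + e + 3 * θ) (hQ : 0 < Q) :
    ∃ C : ℝ, 0 ≤ C ∧ ∀ (N M α : ℝ) (v : Freq (n + 3)), 1 ≤ N → 1 ≤ M →
      ∫⁻ y, Set.indicator {y | PairRegion Q N v y ∧ |pairPhase v y - α| < M}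
        (fun y => ENNReal.ofReal (N ^ (1 + e) * jap y ^ (-(2 * s)))) y
      ≤ ENNReal.ofReal (C * M ^ (1 - θ)) := by
  obtain ⟨C₁, h₁⟩ := setLIntegral_transversal_le (n := n) hs0 hθ0 hθ1 hsn hse hQ
  obtain ⟨C₂, h₂⟩ := setLIntegral_nondegenerate_le (n := n) hs0 hθ0 hθ1 hse hQ
  obtain ⟨C₃, h₃⟩ := setLIntegral_bounded_le (d := n + 3) (Q := Q) hs0 he hθ1
  refine ⟨|C₁| + (|C₂| + |C₃|), by positivity, fun N M α v hN hM => ?_⟩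
  have hMp : 0 ≤ M ^ (1 - θ) := Real.rpow_nonneg (by linarith) _
  have habs : ∀ C : ℝ, ENNReal.ofReal (C * M ^ (1 - θ)) ≤ ENNReal.ofReal (|C| * M ^ (1 - θ)) :=
    fun C => ENNReal.ofReal_le_ofReal (mul_le_mul_of_nonneg_right (le_abs_self C) hMp)
  have hsub : {y | PairRegion Q N v y ∧ |pairPhase v y - α| < M} ⊆
      {y | (N ≤ Q * ‖v - y‖ ∧ ‖v - y‖ ≤ Q * N ∧ 4 * ‖y‖ ≤ ‖v - y‖) ∧ |pairPhase v y - α| < M} ∪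
      ({y | (N ≤ Q * ‖y‖ ∧ ‖y‖ ≤ Q * N ∧ N ≤ Q * ‖v‖ ∧ ‖v‖ ≤ Q * N) ∧ |pairPhase v y - α| < M} ∪
      {y | N ≤ Q ∧ ‖y‖ ≤ Q}) := by
    rintro y ⟨h | h | h, hy⟩
    · exact Or.inl ⟨h, hy⟩
    · exact Or.inr (Or.inl ⟨h, hy⟩)
    · exact Or.inr (Or.inr h)
  refine (lintegral_indicator_le _ _).trans ((lintegral_mono_set hsub).trans
    ((lintegral_union_le _ _ _).trans ?_))
  rw [add_mul, add_mul, ENNReal.ofReal_add (by positivity) (by positivity),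
    ENNReal.ofReal_add (by positivity) (by positivity)]
  refine add_le_add ((h₁ N M α v hN hM).trans (habs _)) ((lintegral_union_le _ _ _).trans
    (add_le_add ((h₂ N M α v hN hM).trans (habs _)) ((h₃ N M _ hN hM fun y hy => hy).trans
      (habs _))))

/-! ### Reduction of the estimates on the hyperplane to pairs -/

/-- The sign with which the frequency `x_j` enters the equation `x_0 + σ = ∑ x_j`. -/
def convSign {k : ℕ} (j : Fin (k + 1)) : ℝ := if j = 0 then 1 else -1

theorem convSign_smul_smul {k d : ℕ} (j : Fin (k + 1)) (y : Freq d) :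
    convSign j • convSign j • y = y := by
  rw [smul_smul]
  by_cases h : j = 0 <;> simp [convSign, h]

theorem hyperplane_iff {k d : ℕ} (σ : Freq d) (x : Config k d) :
    x 0 + σ = ∑ j : Fin k, x j.succ ↔ ∑ j, convSign j • x j + σ = 0 := by
  rw [Fin.sum_univ_succ, ← sub_eq_zero]
  simp only [convSign, Fin.succ_ne_zero, if_true, if_false, one_smul, neg_smul,
    Finset.sum_neg_distrib]
  rw [show x 0 + -∑ j : Fin k, x j.succ + σ = x 0 + σ - ∑ j : Fin k, x j.succ by abel]

theorem lintegral_smul_add_eq {d : ℕ} (F : Freq d → ℝ≥0∞) (c : Freq d) {u : ℝ}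
    (hu : u = 1 ∨ u = -1) : ∫⁻ y, F (u • y + c) = ∫⁻ y, F y := by
  rcases hu with rfl | rfl
  · simp_rw [one_smul]
    exact lintegral_add_right_eq_self F c
  · rw [← lintegral_sub_left_eq_self F c]
    simp_rw [neg_smul, one_smul, neg_add_eq_sub]

theorem lintegral_pi_unique {ι : Type*} [Fintype ι] [Unique ι] {d : ℕ}
    (F : (ι → Freq d) → ℝ≥0∞) : ∫⁻ y, F y = ∫⁻ y : Freq d, F (fun _ => y) := by
  have h := (volume_preserving_funUnique ι (Freq d)).symm.lintegral_comp_emb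
    (MeasurableEquiv.measurableEmbedding _) F
  convert h.symm
  rfl

/-- For a pair `{p, q}` of integrated frequencies, the hyperplane may be parametrized by `x_q`,
whichever of the two frequencies is eliminated. -/
theorem estimate_pair {k d : ℕ} {L : Freq d → ℝ} {D : Freq d → Set (Config k d)}
    {W : Config k d → ℝ} {p q : Fin (k + 1)} (hpq : p ≠ q) {C η : ℝ}
    (h : ∀ (σ : Freq d) (α : ℝ) (z : Config k d) (M : ℝ), 1 ≤ M → ∀ X : Freq d → Config k d,
      (∀ y, X y q = y) → (∀ y j, j ≠ p → j ≠ q → X y j = z j) →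
      (∀ y, X y 0 + σ = ∑ j : Fin k, X y j.succ) →
      ∫⁻ y, (D σ ∩ {x | |resonance L x - α| < M}).indicator (fun x => ENNReal.ofReal (W x)) (X y)
        ≤ ENNReal.ofReal (C * M ^ (1 - η))) :
    Estimate L D W {p, q} C η := by
  intro j₀ hj₀ σ α z M hM
  rcases Finset.mem_insert.1 hj₀ with rfl | hj
  · have hq : q ∈ ({j₀, q} : Finset (Fin (k + 1))).erase j₀ := by simp [hpq.symm]
    let _ : Unique ↥(({j₀, q} : Finset (Fin (k + 1))).erase j₀) :=
      ⟨⟨⟨q, hq⟩⟩, fun ⟨j, hj⟩ => by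
        have : j = q := by simp at hj; tauto
        exact Subtype.ext this⟩
    rw [lintegral_pi_unique]
    refine h σ α z M hM (fun y => slicePoint _ j₀ σ z fun _ => y) (fun y => ?_)
      (fun y j h1 h2 => slicePoint_of_notMem hj₀ _ _ _ (by simp [h1, h2]))
      (fun y => slicePoint_sum _ _ _ _ _)
    simp [slicePoint, partialPoint, hpq.symm]
  · obtain rfl : j₀ = q := by simpa using hj
    have hp : p ∈ ({p, j₀} : Finset (Fin (k + 1))).erase j₀ := by simp [hpq]
    let _ : Unique ↥(({p, j₀} : Finset (Fin (k + 1))).erase j₀) :=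
      ⟨⟨⟨p, hp⟩⟩, fun ⟨j, hj⟩ => by
        have : j = p := by simp at hj; tauto
        exact Subtype.ext this⟩
    rw [lintegral_pi_unique]
    set X' : Freq d → Config k d := fun y => slicePoint {p, j₀} j₀ σ z fun _ => y with hX'
    have hX'p : ∀ y, X' y p = y := fun y => by simp [X', slicePoint, partialPoint, hpq]
    have hX'z : ∀ y j, j ≠ p → j ≠ j₀ → X' y j = z j := fun y j h1 h2 =>
      slicePoint_of_notMem hj₀ _ _ _ (by simp [h1, h2])
    have hX's : ∀ y, X' y 0 + σ = ∑ j : Fin k, X' y j.succ := fun y => slicePoint_sum _ _ _ _ _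
    -- Eliminating `x_q`, the variable is `x_p = u x_q + c` with `u = ± 1`.
    set r : Freq d := ∑ j ∈ Finset.univ \ {p, j₀}, convSign j • z j + σ with hr
    have hrel : ∀ y, convSign p • y + convSign j₀ • X' y j₀ + r = 0 := by
      intro y
      have h1 := (hyperplane_iff _ _).1 (hX's y)
      rw [← Finset.sum_sdiff (Finset.subset_univ {p, j₀}), Finset.sum_pair hpq, hX'p] at h1
      rw [← h1, hr, Finset.sum_congr rfl fun j hj => by
        rw [← hX'z y j (by simp at hj; tauto) (by simp at hj; tauto)]]
      abel
    set u : ℝ := -(convSign p * convSign j₀)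
    set c : Freq d := -(convSign p • r)
    have hu : u = 1 ∨ u = -1 := by
      by_cases h1 : p = 0 <;> by_cases h2 : j₀ = 0 <;> simp [u, convSign, h1, h2]
    rw [← lintegral_smul_add_eq _ c hu]
    refine h σ α z M hM (fun y => X' (u • y + c)) (fun y => ?_) (fun y => hX'z _) (fun y => hX's _)
    have h1 := hrel (u • y + c)
    have h2 : convSign p • (u • y + c) = -(convSign j₀ • y) - r := by
      simp only [u, c, smul_add, smul_neg, neg_smul, convSign_smul_smul, mul_smul]
      abel
    rw [h2] at h1
    have h3 : convSign j₀ • X' (u • y + c) j₀ = convSign j₀ • y := by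
      rw [← sub_eq_zero, ← h1]; abel
    rw [← convSign_smul_smul j₀ (X' (u • y + c) j₀), h3, convSign_smul_smul]

theorem Estimate.mono_const {k d : ℕ} {L : Freq d → ℝ} {D : Freq d → Set (Config k d)}
    {W : Config k d → ℝ} {B : Finset (Fin (k + 1))} {C C' η : ℝ} (h : Estimate L D W B C η)
    (hC : C ≤ C') : Estimate L D W B C' η := fun j₀ hj₀ σ α z M hM =>
  (h j₀ hj₀ σ α z M hM).trans (ENNReal.ofReal_le_ofReal
    (mul_le_mul_of_nonneg_right hC (Real.rpow_nonneg (by linarith) _)))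

theorem estimate_of_eq_empty {k d : ℕ} {L : Freq d → ℝ} {D : Freq d → Set (Config k d)}
    {W : Config k d → ℝ} {B : Finset (Fin (k + 1))} {C η : ℝ} (hD : ∀ σ, D σ = ∅) :
    Estimate L D W B C η := by
  intro j₀ _ σ α z M _
  simp [hD]

theorem univ_fin_three {a p q : Fin 3} (hap : a ≠ p) (haq : a ≠ q) (hpq : p ≠ q) :
    (Finset.univ : Finset (Fin 3)) = {a, p, q} := by
  revert a p q; decide

theorem forall_fin_three {a p q : Fin 3} (hap : a ≠ p) (haq : a ≠ q) (hpq : p ≠ q)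
    {P : Fin 3 → Prop} (ha : P a) (hp : P p) (hq : P q) (j : Fin 3) : P j := by
  have hj : j ∈ ({a, p, q} : Finset (Fin 3)) := univ_fin_three hap haq hpq ▸ Finset.mem_univ j
  simp only [Finset.mem_insert, Finset.mem_singleton] at hj
  rcases hj with rfl | rfl | rfl
  exacts [ha, hp, hq]

theorem sum_fin_three {A : Type*} [AddCommMonoid A] {a p q : Fin 3} (hap : a ≠ p) (haq : a ≠ q)
    (hpq : p ≠ q) (f : Fin 3 → A) : ∑ j, f j = f a + (f p + f q) := by
  rw [univ_fin_three hap haq hpq, Finset.sum_insert (by simp [hap, haq]), Finset.sum_pair hpq]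

theorem prod_fin_three {A : Type*} [CommMonoid A] {a p q : Fin 3} (hap : a ≠ p) (haq : a ≠ q)
    (hpq : p ≠ q) (f : Fin 3 → A) : ∏ j, f j = f a * (f p * f q) := by
  rw [univ_fin_three hap haq hpq, Finset.prod_insert (by simp [hap, haq]), Finset.prod_pair hpq]

/-- Exponents for the weights: regularity `s + s'` is put on `x_q`, `s - s'` on `x_p`, and `s` on
the two other frequencies. -/
def pairExponent (s s' : ℝ) (p q : Fin 3) (j : Fin 4) : ℝ :=
  if j = p.succ then s - s' else if j = q.succ then s + s' else s

theorem pairExponent_add_swap (s s' : ℝ) {p q : Fin 3} (hpq : p ≠ q) (j : Fin 4) :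
    pairExponent s s' p q j + pairExponent s s' q p j = 2 * s := by
  by_cases h1 : j = p.succ
  · have h2 : j ≠ q.succ := fun h => hpq (Fin.succ_injective _ (h1.symm.trans h))
    simp only [pairExponent, if_pos h1, if_neg h2]; ring
  · by_cases h2 : j = q.succ
    · simp only [pairExponent, if_neg h1, if_pos h2]; ring
    · simp only [pairExponent, if_neg h1, if_neg h2]; ring

theorem norm_out_add_norm_shift_le {d : ℕ} {K Q : ℝ} {σ : Freq d} {x : Config 3 d} {a : Fin 3}
    (hx : x ∈ Gam K σ) (hQ : ∀ j : Fin 3, ‖x j.succ‖ ≤ Q * ‖x a.succ‖) :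
    ‖x 0‖ + ‖σ‖ ≤ (3 * Q + 2 * K) * ‖x a.succ‖ := by
  obtain ⟨h1, h2⟩ := hx
  have h3 : x 0 = ∑ j : Fin 3, x j.succ - σ := by rw [← h1]; abel
  have h4 : ‖∑ j : Fin 3, x j.succ‖ ≤ 3 * (Q * ‖x a.succ‖) := by
    refine (norm_sum_le_of_le _ fun j _ => hQ j).trans_eq ?_
    simp
  have h5 : ‖x 0‖ ≤ ‖∑ j : Fin 3, x j.succ‖ + ‖σ‖ := h3 ▸ norm_sub_le _ _
  linarith [h2 a]

/-- Pointwise bound of the weight where `x_a` is, up to a constant, the largest frequency. -/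
theorem weight_pairExponent_le {d : ℕ} {m : Config 3 d → ℝ} {s s' ε e K Q : ℝ}
    (hm : ∀ σ x, x ∈ Gam K σ → |m x| ≤ ‖x 0‖ + ‖σ‖) (hs' : 0 ≤ s') (hss' : s' ≤ s) (he : 0 ≤ e)
    (hεe : ε ≤ e) (hK : 0 ≤ K) (hQ0 : 0 ≤ Q) {a p q : Fin 3} (hap : a ≠ p) (haq : a ≠ q)
    (hpq : p ≠ q) {σ : Freq d} {x : Config 3 d} (hx : x ∈ Gam K σ)
    (hQ : ∀ j : Fin 3, ‖x j.succ‖ ≤ Q * ‖x a.succ‖) :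
    weight m (pairExponent s s' p q) ε x ≤
      (1 + (3 * Q + 2 * K)) ^ (1 + (s + e)) *
        (jap (x a.succ) ^ (1 + e) * jap (x q.succ) ^ (-(2 * s'))) := by
  set B : ℝ := 1 + (3 * Q + 2 * K) with hB
  have hB0 : 0 < B := by positivity
  have hJa := one_le_jap (x a.succ)
  have hJa0 := jap_pos (x a.succ)
  have hJp := one_le_jap (x p.succ)
  have hJq := one_le_jap (x q.succ)
  have hJq0 := jap_pos (x q.succ)
  have hJ0 := one_le_jap (x 0)
  have hbound := norm_out_add_norm_shift_le hx hQ
  have hb2 : (3 * Q + 2 * K) * ‖x a.succ‖ ≤ (3 * Q + 2 * K) * jap (x a.succ) := by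
    gcongr
    exact norm_le_jap _
  have hm1 : |m x| ≤ B * jap (x a.succ) := by
    refine (hm σ x hx).trans (hbound.trans (hb2.trans ?_))
    rw [hB]; linarith
  have hJ1 : jap (x 0) ≤ B * jap (x a.succ) := by
    refine (jap_le_one_add_norm _).trans ?_
    rw [hB]; linarith [norm_nonneg σ]
  have hE0 : pairExponent s s' p q 0 = s := by
    simp [pairExponent, (Fin.succ_ne_zero _).symm]
  have hEa : pairExponent s s' p q a.succ = s := by
    simp [pairExponent, hap, haq]
  have hEp : pairExponent s s' p q p.succ = s - s' := by
    simp [pairExponent]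
  have hEq : pairExponent s s' p q q.succ = s + s' := by
    simp [pairExponent, hpq.symm]
  have h1 : jap (x 0) ^ (s + ε) ≤ B ^ (s + e) * jap (x a.succ) ^ (s + e) := by
    rw [← Real.mul_rpow hB0.le hJa0.le]
    exact (Real.rpow_le_rpow_of_exponent_le hJ0 (by linarith)).trans
      (Real.rpow_le_rpow (by linarith) hJ1 (by linarith))
  have h2 : jap (x a.succ) ^ s * jap (x q.succ) ^ (2 * s') ≤
      jap (x a.succ) ^ s * (jap (x p.succ) ^ (s - s') * jap (x q.succ) ^ (s + s')) := by
    refine mul_le_mul_of_nonneg_left ?_ (by positivity)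
    refine (Real.rpow_le_rpow_of_exponent_le hJq (by linarith : 2 * s' ≤ s + s')).trans ?_
    exact le_mul_of_one_le_left (by positivity) (Real.one_le_rpow hJp (by linarith))
  rw [weight, prod_fin_three hap haq hpq, hE0, hEa, hEp, hEq]
  calc |m x| * jap (x 0) ^ (s + ε) /
        (jap (x a.succ) ^ s * (jap (x p.succ) ^ (s - s') * jap (x q.succ) ^ (s + s')))
      ≤ (B * jap (x a.succ)) * (B ^ (s + e) * jap (x a.succ) ^ (s + e)) /
        (jap (x a.succ) ^ s * jap (x q.succ) ^ (2 * s')) := by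
        gcongr
    _ = _ := by
        rw [Real.rpow_add hB0 1, Real.rpow_add hJa0 s, Real.rpow_add hJa0 1, Real.rpow_neg hJq0.le,
          Real.rpow_one, Real.rpow_one]
        field_simp

theorem zkSymbol_apply {n : ℕ} (hd : 0 < n + 3) (ξ : Freq (n + 3)) :
    zkSymbol hd ξ = ξ 0 * ‖ξ‖ ^ 2 := rfl

section PairEstimates

variable {n : ℕ} {m : Config 3 (n + 3) → ℝ} {s s' ε e θ K Q : ℝ}

/-- The estimate for the integral over two ingoing frequencies. -/
theorem estimate_ingoing_pair (hd : 0 < n + 3)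
    (hm : ∀ σ x, x ∈ Gam K σ → |m x| ≤ ‖x 0‖ + ‖σ‖) (hs' : 0 ≤ s') (hss' : s' ≤ s)
    (he : 0 ≤ e) (hεe : ε ≤ e) (hθ0 : 0 < θ) (hθ1 : θ ≤ 1) (hsn : 2 * s' < n + 2)
    (hse : 2 * s' = n + 1 + e + 3 * θ) (hK : 0 ≤ K) (hQ0 : 0 < Q) :
    ∃ C : ℝ, ∀ (a p q : Fin 3) (i : Fin 4) (D : Freq (n + 3) → Set (Config 3 (n + 3))),
      a ≠ p → a ≠ q → p ≠ q → i ≠ a.succ → i ≠ q.succ →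
      (∀ σ x, x ∈ D σ → x ∈ Gam K σ ∧ (∀ j : Fin 3, ‖x j.succ‖ ≤ Q * ‖x a.succ‖) ∧
        jap (x a.succ) ≤ Q * jap (x i) ∧
        PairRegion Q (jap (x i)) (x a.succ + x q.succ) (x q.succ)) →
      Estimate (zkSymbol hd) D (weight m (pairExponent s s' p q) ε) {a.succ, q.succ} C θ := by
  obtain ⟨C, hC0, hC⟩ := lintegral_pairRegion_le (n := n) hs' he hθ0 hθ1 hsn hse hQ0
  set C₀ : ℝ := (1 + (3 * Q + 2 * K)) ^ (1 + (s + e)) * Q ^ (1 + e) with hC₀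
  have hC₀0 : 0 ≤ C₀ := by positivity
  refine ⟨C₀ * C, fun a p q i D hap haq hpq hia hiq hD => ?_⟩
  refine estimate_pair (fun h => haq (Fin.succ_injective _ h)) fun σ α z M hM X hXq hXz hXs => ?_
  have hX0 : ∀ y, X y 0 = z 0 := fun y =>
    hXz y 0 (Fin.succ_ne_zero _).symm (Fin.succ_ne_zero _).symm
  have hXp : ∀ y, X y p.succ = z p.succ := fun y =>
    hXz y _ (fun h => hap (Fin.succ_injective _ h).symm) (fun h => hpq (Fin.succ_injective _ h))
  set v : Freq (n + 3) := z 0 + σ - z p.succ with hv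
  have hXa : ∀ y, X y a.succ = v - y := by
    intro y
    have := hXs y
    rw [sum_fin_three hap haq hpq, hX0, hXp, hXq] at this
    rw [hv, this]; abel
  set α' : ℝ := zkSymbol hd (z 0) - zkSymbol hd (z p.succ) - α with hα'
  have hpt : ∀ y, (D σ ∩ {x | |resonance (zkSymbol hd) x - α| < M}).indicator
      (fun x => ENNReal.ofReal (weight m (pairExponent s s' p q) ε x)) (X y) ≤
      ENNReal.ofReal C₀ *
        Set.indicator {y | PairRegion Q (jap (z i)) v y ∧ |pairPhase v y - α'| < M}
        (fun y => ENNReal.ofReal (jap (z i) ^ (1 + e) * jap y ^ (-(2 * s')))) y := by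
    intro y
    refine Set.indicator_apply_le' ?_ (fun _ => zero_le)
    rintro ⟨hxD, hxM⟩
    obtain ⟨hG, hQ, hji, hR⟩ := hD σ _ hxD
    rw [hXz y i hia hiq] at hji hR
    rw [hXa, hXq, sub_add_cancel] at hR
    have hphase : |pairPhase v y - α'| < M := by
      have hx : |resonance (zkSymbol hd) (X y) - α| < M := hxM
      rw [resonance, sum_fin_three hap haq hpq, hX0, hXp, hXq, hXa] at hx
      rw [← abs_neg]
      convert hx using 2
      simp only [hα', pairPhase, zkSymbol_apply]
      ring
    have hmem : y ∈ {y | PairRegion Q (jap (z i)) v y ∧ |pairPhase v y - α'| < M} := ⟨hR, hphase⟩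
    rw [Set.indicator_of_mem hmem, ← ENNReal.ofReal_mul hC₀0]
    refine ENNReal.ofReal_le_ofReal
      ((weight_pairExponent_le hm hs' hss' he hεe hK hQ0.le hap haq hpq hG hQ).trans ?_)
    rw [hXq, hC₀, mul_assoc]
    have h0 := jap_pos y
    have h1 : jap (X y a.succ) ^ (1 + e) ≤ Q ^ (1 + e) * jap (z i) ^ (1 + e) := by
      rw [← Real.mul_rpow hQ0.le (jap_pos _).le]
      exact Real.rpow_le_rpow (jap_pos _).le hji (by linarith)
    rw [← mul_assoc (Q ^ (1 + e))]
    gcongr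
  refine (lintegral_mono hpt).trans ?_
  rw [lintegral_const_mul' _ _ ENNReal.ofReal_ne_top, mul_assoc, ENNReal.ofReal_mul hC₀0]
  gcongr
  exact hC _ M α' v (one_le_jap _) hM

/-- The estimate for the integral over the outgoing frequency and one ingoing frequency. Since `L` is
odd, the phase is that of a pair of ingoing frequencies, after a reflection. -/
theorem estimate_outgoing_pair (hd : 0 < n + 3)
    (hm : ∀ σ x, x ∈ Gam K σ → |m x| ≤ ‖x 0‖ + ‖σ‖) (hs' : 0 ≤ s') (hss' : s' ≤ s)
    (he : 0 ≤ e) (hεe : ε ≤ e) (hθ0 : 0 < θ) (hθ1 : θ ≤ 1) (hsn : 2 * s' < n + 2)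
    (hse : 2 * s' = n + 1 + e + 3 * θ) (hK : 0 ≤ K) (hQ0 : 0 < Q) :
    ∃ C : ℝ, ∀ (a p q : Fin 3) (D : Freq (n + 3) → Set (Config 3 (n + 3))),
      a ≠ p → a ≠ q → p ≠ q →
      (∀ σ x, x ∈ D σ → x ∈ Gam K σ ∧ (∀ j : Fin 3, ‖x j.succ‖ ≤ Q * ‖x a.succ‖) ∧
        PairRegion Q (jap (x a.succ)) (x 0 - x p.succ) (-x p.succ)) →
      Estimate (zkSymbol hd) D (weight m (pairExponent s s' q p) ε) {0, p.succ} C θ := by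
  obtain ⟨C, hC0, hC⟩ := lintegral_pairRegion_le (n := n) hs' he hθ0 hθ1 hsn hse hQ0
  set C₀ : ℝ := (1 + (3 * Q + 2 * K)) ^ (1 + (s + e)) with hC₀
  have hC₀0 : 0 ≤ C₀ := by positivity
  refine ⟨C₀ * C, fun a p q D hap haq hpq hD => ?_⟩
  refine estimate_pair (Fin.succ_ne_zero _).symm fun σ α z M hM X hXp hXz hXs => ?_
  have hXa : ∀ y, X y a.succ = z a.succ := fun y =>
    hXz y _ (Fin.succ_ne_zero _) (fun h => hap (Fin.succ_injective _ h))
  have hXq : ∀ y, X y q.succ = z q.succ := fun y =>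
    hXz y _ (Fin.succ_ne_zero _) (fun h => hpq (Fin.succ_injective _ h).symm)
  set w : Freq (n + 3) := z a.succ + z q.succ - σ with hw
  have hX0 : ∀ y, X y 0 = w + y := by
    intro y
    have := hXs y
    rw [sum_fin_three hap haq hpq, hXa, hXp, hXq] at this
    rw [eq_sub_of_add_eq this, hw]; abel
  set α' : ℝ := α + zkSymbol hd (z a.succ) + zkSymbol hd (z q.succ) with hα'
  set G : Freq (n + 3) → ℝ≥0∞ := fun y => ENNReal.ofReal C₀ * Set.indicator
    {y | PairRegion Q (jap (z a.succ)) w y ∧ |pairPhase w y - α'| < M}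
    (fun y => ENNReal.ofReal (jap (z a.succ) ^ (1 + e) * jap y ^ (-(2 * s')))) y with hG
  have hpt : ∀ y, (D σ ∩ {x | |resonance (zkSymbol hd) x - α| < M}).indicator
      (fun x => ENNReal.ofReal (weight m (pairExponent s s' q p) ε x)) (X y) ≤ G (-y) := by
    intro y
    refine Set.indicator_apply_le' ?_ (fun _ => zero_le)
    rintro ⟨hxD, hxM⟩
    obtain ⟨hGam, hQ, hR⟩ := hD σ _ hxD
    rw [hXa, hX0, hXp, add_sub_cancel_right] at hR
    have hphase : |pairPhase w (-y) - α'| < M := by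
      have hx : |resonance (zkSymbol hd) (X y) - α| < M := hxM
      rw [resonance, sum_fin_three hap haq hpq, hX0, hXp, hXq, hXa] at hx
      convert hx using 2
      simp only [hα', pairPhase, zkSymbol_apply, sub_neg_eq_add, norm_neg, PiLp.neg_apply]
      ring
    rw [hG]
    simp only
    have hmem : -y ∈ {y | PairRegion Q (jap (z a.succ)) w y ∧ |pairPhase w y - α'| < M} :=
      ⟨hR, hphase⟩
    rw [Set.indicator_of_mem hmem, ← ENNReal.ofReal_mul hC₀0]
    refine ENNReal.ofReal_le_ofReal
      ((weight_pairExponent_le hm hs' hss' he hεe hK hQ0.le haq hap hpq.symm hGam hQ).trans_eq ?_)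
    rw [hXp, hXa, jap_neg]
  refine (lintegral_mono hpt).trans ?_
  rw [lintegral_neg_eq_self G, hG, lintegral_const_mul' _ _ ENNReal.ofReal_ne_top, mul_assoc,
    ENNReal.ofReal_mul hC₀0]
  gcongr
  exact hC _ M α' w (one_le_jap _) hM

end PairEstimates

/-! ### Decomposition of the frequency space -/

/-- The sum of the sizes of the ingoing frequencies. -/
def totalSize {d : ℕ} (x : Config 3 d) : ℝ := ∑ j : Fin 3, ‖x j.succ‖

/-- `x_a` is large and dominates the two other ingoing frequencies. -/
def oneLarge {d : ℕ} (Λ : ℝ) (a p q : Fin 3) : Set (Config 3 d) :=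
  {x | ‖x q.succ‖ ≤ ‖x p.succ‖ ∧ Λ * ‖x p.succ‖ ≤ ‖x a.succ‖ ∧ 1 ≤ ‖x a.succ‖}

/-- `x_a` and `x_p` are large and comparable, and dominate `x_q`. -/
def twoLarge {d : ℕ} (Λ : ℝ) (a p q : Fin 3) : Set (Config 3 d) :=
  {x | ‖x p.succ‖ ≤ ‖x a.succ‖ ∧ ‖x a.succ‖ ≤ Λ * ‖x p.succ‖ ∧ Λ * ‖x q.succ‖ ≤ ‖x a.succ‖ ∧
    1 ≤ ‖x a.succ‖}

/-- The three ingoing frequencies are comparable, and not all small. -/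
def comparable {d : ℕ} (Λ : ℝ) : Set (Config 3 d) :=
  {x | 1 ≤ totalSize x ∧ ∀ j : Fin 3, totalSize x ≤ 3 * Λ * ‖x j.succ‖}

/-- Comparable frequencies for which both `x_a + x_q`, the vector of the quadratic phase of the pair
`{a, q}`, and `x_0 - x_p`, that of the pair `{0, p}`, have the size of the frequencies. -/
def nondegenerate {d : ℕ} (Λ τ : ℝ) (a p q : Fin 3) : Set (Config 3 d) :=
  comparable Λ ∩ {x | τ * totalSize x ≤ ‖x a.succ + x q.succ‖ ∧
    τ * totalSize x ≤ ‖x 0 - x p.succ‖}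

/-- All frequencies are bounded, and `x_a` is the largest ingoing one. -/
def allSmall {d : ℕ} (a : Fin 3) : Set (Config 3 d) :=
  {x | (∀ j : Fin 3, ‖x j.succ‖ ≤ ‖x a.succ‖) ∧ ‖x a.succ‖ ≤ 1}

/-- Comparable frequencies close to the stationary configuration `(ξ, ξ, ξ, ξ)`, where `σ = 2ξ`. -/
def nearEqual {d : ℕ} (Λ τ : ℝ) : Set (Config 3 d) :=
  comparable Λ ∩ {x | ∀ j : Fin 3, ‖x 0 - x j.succ‖ < τ * totalSize x}

/-- Comparable frequencies close to the stationary configuration in which `x_a = ξ` and the two other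
ingoing frequencies are `-ξ`, so that `σ = -2ξ`. -/
def nearOpposite {d : ℕ} (Λ τ : ℝ) (a p q : Fin 3) : Set (Config 3 d) :=
  comparable Λ ∩ {x | ‖x 0 - x a.succ‖ < τ * totalSize x ∧
    ‖x a.succ + x p.succ‖ < τ * totalSize x ∧ ‖x a.succ + x q.succ‖ < τ * totalSize x}

section Measurability

variable {d : ℕ} (Λ τ : ℝ) (a p q : Fin 3)

theorem continuous_totalSize : Continuous (totalSize : Config 3 d → ℝ) := by
  unfold totalSize; fun_prop

theorem measurableSet_oneLarge : MeasurableSet (oneLarge Λ a p q : Set (Config 3 d)) := by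
  simp only [oneLarge, Set.ofPred_and]
  exact ((isClosed_le (by fun_prop) (by fun_prop)).inter ((isClosed_le (by fun_prop)
    (by fun_prop)).inter (isClosed_le (by fun_prop) (by fun_prop)))).measurableSet

theorem measurableSet_twoLarge : MeasurableSet (twoLarge Λ a p q : Set (Config 3 d)) := by
  simp only [twoLarge, Set.ofPred_and]
  exact ((isClosed_le (by fun_prop) (by fun_prop)).inter ((isClosed_le (by fun_prop)
    (by fun_prop)).inter ((isClosed_le (by fun_prop) (by fun_prop)).inter
    (isClosed_le (by fun_prop) (by fun_prop))))).measurableSet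

theorem measurableSet_comparable : MeasurableSet (comparable Λ : Set (Config 3 d)) := by
  have := continuous_totalSize (d := d)
  simp only [comparable, Set.ofPred_and, Set.ofPred_forall]
  exact ((isClosed_le (by fun_prop) (by fun_prop)).inter
    (isClosed_iInter fun j => isClosed_le (by fun_prop) (by fun_prop))).measurableSet

theorem measurableSet_nondegenerate :
    MeasurableSet (nondegenerate Λ τ a p q : Set (Config 3 d)) := by
  have := continuous_totalSize (d := d)
  simp only [nondegenerate, Set.ofPred_and]
  exact (measurableSet_comparable Λ).inter ((isClosed_le (by fun_prop) (by fun_prop)).inter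
    (isClosed_le (by fun_prop) (by fun_prop))).measurableSet

theorem measurableSet_allSmall : MeasurableSet (allSmall a : Set (Config 3 d)) := by
  simp only [allSmall, Set.ofPred_and, Set.ofPred_forall]
  exact ((isClosed_iInter fun j => isClosed_le (by fun_prop) (by fun_prop)).inter
    (isClosed_le (by fun_prop) (by fun_prop))).measurableSet

theorem measurableSet_nearEqual : MeasurableSet (nearEqual Λ τ : Set (Config 3 d)) := by
  have := continuous_totalSize (d := d)
  simp only [nearEqual, Set.ofPred_forall]
  exact (measurableSet_comparable Λ).inter
    (isOpen_iInter_of_finite fun j => isOpen_lt (by fun_prop) (by fun_prop)).measurableSet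

theorem measurableSet_nearOpposite :
    MeasurableSet (nearOpposite Λ τ a p q : Set (Config 3 d)) := by
  have := continuous_totalSize (d := d)
  simp only [nearOpposite, Set.ofPred_and]
  exact (measurableSet_comparable Λ).inter ((isOpen_lt (by fun_prop) (by fun_prop)).inter
    ((isOpen_lt (by fun_prop) (by fun_prop)).inter
    (isOpen_lt (by fun_prop) (by fun_prop)))).measurableSet

end Measurability

theorem norm_le_totalSize {d : ℕ} (x : Config 3 d) (j : Fin 3) : ‖x j.succ‖ ≤ totalSize x :=
  Finset.single_le_sum (f := fun j : Fin 3 => ‖x j.succ‖) (fun _ _ => norm_nonneg _)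
    (Finset.mem_univ j)

theorem exists_norm_sorted {d : ℕ} (x : Config 3 d) : ∃ a p q : Fin 3, a ≠ p ∧ a ≠ q ∧ p ≠ q ∧
    ‖x p.succ‖ ≤ ‖x a.succ‖ ∧ ‖x q.succ‖ ≤ ‖x p.succ‖ := by
  set f : Fin 3 → ℝ := fun j => -‖x j.succ‖ with hf
  have hmono := Tuple.monotone_sort f
  set π := Tuple.sort f
  refine ⟨π 0, π 1, π 2, π.injective.ne (by decide), π.injective.ne (by decide),
    π.injective.ne (by decide), ?_, ?_⟩
  · exact neg_le_neg_iff.1 (hmono (by decide : (0 : Fin 3) ≤ 1))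
  · exact neg_le_neg_iff.1 (hmono (by decide : (1 : Fin 3) ≤ 2))

/-- Among comparable frequencies, the degeneracy of all pairings forces the configuration to be close
to one of the two kinds of stationary configurations. -/
theorem comparable_cover {d : ℕ} {Λ τ : ℝ} (hΛ : 1 ≤ Λ) (hτ : 24 * τ * Λ ≤ 1)
    {x : Config 3 d} (hx : x ∈ comparable Λ) :
    x ∈ nearEqual Λ τ ∨ ∃ a p q : Fin 3, a ≠ p ∧ a ≠ q ∧ p ≠ q ∧
      (x ∈ nondegenerate Λ τ a p q ∨ x ∈ nearOpposite Λ τ a p q) := by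
  by_contra! hcon
  obtain ⟨hne, hcon⟩ := hcon
  set N := totalSize x with hN
  have hN1 : 1 ≤ N := hx.1
  have hτN : 24 * (τ * N) * Λ ≤ N := by nlinarith
  have hpair : ∀ a p q : Fin 3, a ≠ p → a ≠ q → p ≠ q →
      ‖x a.succ + x q.succ‖ < τ * N ∨ ‖x 0 - x p.succ‖ < τ * N := by
    intro a p q h1 h2 h3
    by_contra! h
    exact (hcon a p q h1 h2 h3).1 ⟨hx, h⟩
  have hlow : ∀ j : Fin 3, 8 * (τ * N) ≤ ‖x j.succ‖ := by
    intro j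
    have h1 := hx.2 j
    have h2 : 24 * (τ * N) * Λ ≤ 3 * Λ * ‖x j.succ‖ := hτN.trans h1
    nlinarith
  have hpos : ∀ j : Fin 3, 0 < ‖x j.succ‖ := by
    intro j
    have h1 := hx.2 j
    by_contra! h
    have : ‖x j.succ‖ = 0 := le_antisymm h (norm_nonneg _)
    rw [this] at h1
    linarith
  by_cases hall : ∀ j : Fin 3, ‖x 0 - x j.succ‖ < τ * N
  · exact hne ⟨hx, hall⟩
  push Not at hall
  obtain ⟨p, hp⟩ := hall
  obtain ⟨a, q, hap, haq, hpq⟩ : ∃ a q : Fin 3, a ≠ p ∧ a ≠ q ∧ p ≠ q := by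
    clear * - p
    revert p; decide
  have h1 : ‖x a.succ + x q.succ‖ < τ * N := (hpair a p q hap haq hpq).resolve_right (not_lt.2 hp)
  rcases lt_or_ge ‖x 0 - x a.succ‖ (τ * N) with ha | ha <;>
    rcases lt_or_ge ‖x 0 - x q.succ‖ (τ * N) with hq | hq
  · -- `x₀ ≈ x_a ≈ x_q` and `x_a + x_q ≈ 0` would make `x_a` small.
    have e : (2 : ℝ) • x a.succ =
        (x a.succ + x q.succ) + (x 0 - x q.succ) - (x 0 - x a.succ) := by module
    have h2 : 2 * ‖x a.succ‖ ≤ τ * N + τ * N + τ * N := by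
      have : ‖(2 : ℝ) • x a.succ‖ = 2 * ‖x a.succ‖ := by rw [norm_smul]; norm_num
      rw [← this, e]
      refine (norm_sub_le _ _).trans (add_le_add ((norm_add_le _ _).trans ?_) ha.le)
      linarith
    have := hlow a
    have := hpos a
    linarith
  · have h2 := (hpair p q a hpq hap.symm haq.symm).resolve_right (not_lt.2 hq)
    exact (hcon a p q hap haq hpq).2 ⟨hx, ha, by rwa [add_comm], h1⟩
  · have h2 := (hpair p a q hap.symm hpq haq).resolve_right (not_lt.2 ha)
    exact (hcon q p a hpq.symm haq.symm hap.symm).2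
      ⟨hx, hq, by rwa [add_comm], by rwa [add_comm]⟩
  · -- All pair sums are small, hence so is every frequency.
    have h2 := (hpair p q a hpq hap.symm haq.symm).resolve_right (not_lt.2 hq)
    have h3 := (hpair p a q hap.symm hpq haq).resolve_right (not_lt.2 ha)
    have e : (2 : ℝ) • x a.succ =
        (x a.succ + x q.succ) + (x p.succ + x a.succ) - (x p.succ + x q.succ) := by module
    have h4 : 2 * ‖x a.succ‖ ≤ τ * N + τ * N + τ * N := by
      have : ‖(2 : ℝ) • x a.succ‖ = 2 * ‖x a.succ‖ := by rw [norm_smul]; norm_num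
      rw [← this, e]
      refine (norm_sub_le _ _).trans (add_le_add ((norm_add_le _ _).trans ?_) h3.le)
      linarith
    have := hlow a
    have := hpos a
    linarith

theorem region_cover {d : ℕ} {Λ τ : ℝ} (hΛ : 1 ≤ Λ) (hτ : 24 * τ * Λ ≤ 1) (x : Config 3 d) :
    ∃ a p q : Fin 3, a ≠ p ∧ a ≠ q ∧ p ≠ q ∧
      (x ∈ oneLarge Λ a p q ∨ x ∈ twoLarge Λ a p q ∨ x ∈ nondegenerate Λ τ a p q ∨
        x ∈ allSmall a ∨ x ∈ nearEqual Λ τ ∨ x ∈ nearOpposite Λ τ a p q) := by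
  obtain ⟨a, p, q, hap, haq, hpq, h1, h2⟩ := exists_norm_sorted x
  have hmax : ∀ j : Fin 3, ‖x j.succ‖ ≤ ‖x a.succ‖ :=
    forall_fin_three hap haq hpq le_rfl h1 (h2.trans h1)
  rcases le_total ‖x a.succ‖ 1 with h3 | h3
  · exact ⟨a, p, q, hap, haq, hpq, Or.inr (Or.inr (Or.inr (Or.inl ⟨hmax, h3⟩)))⟩
  rcases le_total (Λ * ‖x p.succ‖) ‖x a.succ‖ with h4 | h4
  · exact ⟨a, p, q, hap, haq, hpq, Or.inl ⟨h2, h4, h3⟩⟩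
  rcases le_total (Λ * ‖x q.succ‖) ‖x a.succ‖ with h5 | h5
  · exact ⟨a, p, q, hap, haq, hpq, Or.inr (Or.inl ⟨h1, h4, h5, h3⟩)⟩
  have hcomp : x ∈ comparable Λ := by
    have htot : totalSize x ≤ 3 * ‖x a.succ‖ := by
      rw [totalSize, sum_fin_three hap haq hpq]; linarith
    have hle : ∀ j : Fin 3, ‖x a.succ‖ ≤ Λ * ‖x j.succ‖ :=
      forall_fin_three hap haq hpq (le_mul_of_one_le_left (norm_nonneg _) hΛ) h4 h5
    exact ⟨h3.trans (norm_le_totalSize x a), fun j => by have := hle j; linarith⟩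
  rcases comparable_cover hΛ hτ hcomp with h | ⟨a', p', q', h6, h7, h8, h | h⟩
  · exact ⟨a, p, q, hap, haq, hpq, by tauto⟩
  · exact ⟨a', p', q', h6, h7, h8, by tauto⟩
  · exact ⟨a', p', q', h6, h7, h8, by tauto⟩

/-- Near a stationary configuration the shift `σ` is close to the corresponding multiple of `ξ`,
which is excluded. -/
theorem notMem_avoid {d : ℕ} {Λ τ κ δ c : ℝ} {σ : Freq d} {x : Config 3 d}
    (hκ : 12 * τ * Λ ≤ κ - 1) (hδ0 : 0 < δ) (hδ : 18 * τ * Λ ≤ δ) (hτ : 24 * τ * Λ ≤ 1)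
    (hΛ : 0 < Λ) (hx : x ∈ comparable Λ)
    (hsize : ∀ j : Fin 3, |‖x j.succ‖ - ‖x 0‖| ≤ 2 * (τ * totalSize x))
    (hσ : ‖σ - c • x 0‖ ≤ 3 * (τ * totalSize x)) : x ∉ Avoid κ δ c σ := by
  intro hav
  set N := totalSize x with hN
  have hN1 : 1 ≤ N := hx.1
  have h1 : δ * ‖x 0‖ ≤ ‖σ - c • x 0‖ := by
    refine hav fun i j => ?_
    have hi := abs_le.1 (hsize i)
    have hj := abs_le.1 (hsize j)
    have hτ4 : 4 * (τ * N) ≤ (κ - 1) * ‖x j.succ‖ := by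
      rcases le_total τ 0 with h | h
      · have h1 : 0 ≤ 4 * (τ * N) := by linarith [abs_nonneg (‖x j.succ‖ - ‖x 0‖), hsize j]
        have h2 : τ = 0 := by nlinarith
        rw [h2] at hκ ⊢
        have := norm_nonneg (x j.succ)
        nlinarith
      · calc 4 * (τ * N) ≤ 4 * (τ * (3 * Λ * ‖x j.succ‖)) := by
              have := hx.2 j
              gcongr
          _ = 12 * τ * Λ * ‖x j.succ‖ := by ring
          _ ≤ _ := by gcongr
    linarith
  have h2 := hx.2 0
  have h3 := abs_le.1 (hsize 0)
  -- `Λ |x₀|` is at least `N / 4`, whereas `3 τ N Λ` is at most `δ N / 6`.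
  have h4 : N ≤ 4 * (Λ * ‖x 0‖) := by nlinarith
  have h5 : δ * N ≤ 4 * (Λ * (3 * (τ * N))) := by
    have := h1.trans hσ
    calc δ * N ≤ δ * (4 * (Λ * ‖x 0‖)) := by gcongr
      _ = 4 * (Λ * (δ * ‖x 0‖)) := by ring
      _ ≤ _ := by gcongr
  nlinarith

theorem notMem_avoid_of_nearEqual {d : ℕ} {K Λ τ κ δ : ℝ} {σ : Freq d} {x : Config 3 d}
    (hκ : 12 * τ * Λ ≤ κ - 1) (hδ0 : 0 < δ) (hδ : 18 * τ * Λ ≤ δ) (hτ : 24 * τ * Λ ≤ 1)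
    (hΛ : 0 < Λ) (hx : x ∈ nearEqual Λ τ) (hG : x ∈ Gam K σ) : x ∉ Avoid κ δ 2 σ := by
  obtain ⟨hc, hn⟩ := hx
  have hn' : ∀ j : Fin 3, ‖x 0 - x j.succ‖ < τ * totalSize x := hn
  have hpos : 0 ≤ τ * totalSize x := (norm_nonneg _).trans (hn' 0).le
  refine notMem_avoid hκ hδ0 hδ hτ hΛ hc (fun j => ?_) ?_
  · rw [abs_sub_comm]
    linarith [abs_norm_sub_norm_le (x 0) (x j.succ), hn' j]
  · have e : σ - (2 : ℝ) • x 0 = ∑ j : Fin 3, (x j.succ - x 0) := by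
      rw [Finset.sum_sub_distrib, ← hG.1, Finset.sum_const, Finset.card_univ, Fintype.card_fin]
      module
    rw [e]
    refine (norm_sum_le_of_le _ fun j _ => ?_).trans_eq (b := ∑ _j : Fin 3, τ * totalSize x) ?_
    · rw [norm_sub_rev]; exact (hn' j).le
    · simp

theorem notMem_avoid_of_nearOpposite {d : ℕ} {K Λ τ κ δ : ℝ} {σ : Freq d} {x : Config 3 d}
    {a p q : Fin 3} (hap : a ≠ p) (haq : a ≠ q) (hpq : p ≠ q)
    (hκ : 12 * τ * Λ ≤ κ - 1) (hδ0 : 0 < δ) (hδ : 18 * τ * Λ ≤ δ) (hτ : 24 * τ * Λ ≤ 1)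
    (hΛ : 0 < Λ) (hx : x ∈ nearOpposite Λ τ a p q) (hG : x ∈ Gam K σ) : x ∉ Avoid κ δ (-2) σ := by
  obtain ⟨hc, h1, h2, h3⟩ := hx
  have ha := abs_norm_sub_norm_le (x 0) (x a.succ)
  have hneg : ∀ j : Fin 3, |‖x a.succ‖ - ‖x j.succ‖| ≤ ‖x a.succ + x j.succ‖ := by
    intro j
    have := abs_norm_sub_norm_le (x a.succ) (-x j.succ)
    rwa [norm_neg, sub_neg_eq_add] at this
  have ha' := abs_le.1 ha
  have hpos := norm_nonneg (x 0 - x a.succ)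
  have hp' := abs_le.1 (hneg p)
  have hq' := abs_le.1 (hneg q)
  refine notMem_avoid hκ hδ0 hδ hτ hΛ hc (forall_fin_three hap haq hpq ?_ ?_ ?_) ?_
  · rw [abs_le]; constructor <;> linarith
  · rw [abs_le]; constructor <;> linarith
  · rw [abs_le]; constructor <;> linarith
  · have e : σ - (-2 : ℝ) • x 0 =
        (x 0 - x a.succ) + ((x a.succ + x p.succ) + (x a.succ + x q.succ)) := by
      have := hG.1
      rw [sum_fin_three hap haq hpq] at this
      rw [← sub_eq_iff_eq_add'.2 this.symm]
      module
    rw [e]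
    refine (norm_add_le _ _).trans ?_
    linarith [norm_add_le (x a.succ + x p.succ) (x a.succ + x q.succ)]

/-! ### Admissible regions and the flexible estimate -/

/-- The conditions under which both estimates for the pairs `{a, q}` and `{0, p}` hold at `x`: `x_a` is
the largest ingoing frequency up to a constant, it is comparable with the frozen frequency `x_i`, and
both pairs lie in a good region. -/
def PairAdmissible {d : ℕ} (Q : ℝ) (i : Fin 4) (a p q : Fin 3) (x : Config 3 d) : Prop :=
  (∀ j : Fin 3, ‖x j.succ‖ ≤ Q * ‖x a.succ‖) ∧ jap (x a.succ) ≤ Q * jap (x i) ∧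
    PairRegion Q (jap (x i)) (x a.succ + x q.succ) (x q.succ) ∧
    PairRegion Q (jap (x a.succ)) (x 0 - x p.succ) (-x p.succ)

theorem le_mul_of_le_const_mul {A B c Q : ℝ} (h : A ≤ c * B) (hc : c ≤ Q) (hB : 0 ≤ B) :
    A ≤ Q * B := h.trans (mul_le_mul_of_nonneg_right hc hB)

section Regions

variable {d : ℕ} {K Λ τ Q : ℝ} {σ : Freq d} {x : Config 3 d} {a p q : Fin 3}

theorem sub_eq_of_mem_gam (hap : a ≠ p) (haq : a ≠ q) (hpq : p ≠ q) (hG : x ∈ Gam K σ) :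
    x 0 - x p.succ = x a.succ + (x q.succ - σ) := by
  have := hG.1
  rw [sum_fin_three hap haq hpq] at this
  rw [eq_sub_of_add_eq this]; abel

theorem norm_add_bounds {E : Type*} [SeminormedAddCommGroup E] {u w : E} {ρ : ℝ}
    (h : ‖w‖ ≤ ρ) : ‖u‖ - ρ ≤ ‖u + w‖ ∧ ‖u + w‖ ≤ ‖u‖ + ρ := by
  refine ⟨?_, (norm_add_le _ _).trans (by linarith)⟩
  have := norm_sub_le (u + w) w
  rw [add_sub_cancel_right] at this
  linarith

theorem pairAdmissible_of_oneLarge (hK : 0 < K) (hΛ : 12 + 2 * K ≤ Λ) (hQ : 6 * Λ * (1 + K) ≤ Q)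
    (hap : a ≠ p) (haq : a ≠ q) (hpq : p ≠ q) (hx : x ∈ oneLarge Λ a p q) (hG : x ∈ Gam K σ) :
    PairAdmissible Q 0 a p q x := by
  obtain ⟨h1, h2, h3⟩ := hx
  have hQ72 : 72 ≤ Q := by nlinarith
  have hp0 := norm_nonneg (x p.succ)
  have hq0 := norm_nonneg (x q.succ)
  have hx0' := norm_nonneg (x 0)
  have hσ := hG.2 q
  have hKq : K * ‖x q.succ‖ ≤ K * ‖x p.succ‖ := by gcongr
  have hΛp : (12 + 2 * K) * ‖x p.succ‖ ≤ ‖x a.succ‖ :=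
    (mul_le_mul_of_nonneg_right hΛ hp0).trans h2
  have hKp : 0 ≤ K * ‖x p.succ‖ := by positivity
  have e : x 0 = x a.succ + (x p.succ + x q.succ - σ) := by
    rw [eq_add_of_sub_eq (sub_eq_of_mem_gam hap haq hpq hG)]; abel
  have hr : ‖x p.succ + x q.succ - σ‖ ≤ 1 / 2 * ‖x a.succ‖ := by
    refine (norm_sub_le _ _).trans ?_
    linarith [norm_add_le (x p.succ) (x q.succ)]
  have hx0 := norm_add_bounds (u := x a.succ) hr
  rw [← e] at hx0
  have j1 := jap_le_one_add_norm (x a.succ)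
  have j2 := jap_le_one_add_norm (x 0)
  have j3 := norm_le_jap (x a.succ)
  have j4 := norm_le_jap (x 0)
  refine ⟨forall_fin_three hap haq hpq ?_ ?_ ?_, ?_, Or.inl ⟨?_, ?_, ?_⟩, Or.inl ⟨?_, ?_, ?_⟩⟩
  · exact le_mul_of_one_le_left (by linarith) (by linarith)
  · exact le_mul_of_le_const_mul (c := 1) (by linarith) (by linarith) (by linarith)
  · exact le_mul_of_le_const_mul (c := 1) (by linarith) (by linarith) (by linarith)
  · exact le_mul_of_le_const_mul (c := 4) (by linarith) (by linarith) (by linarith)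
  · rw [add_sub_cancel_right]
    exact le_mul_of_le_const_mul (c := 3) (by linarith) (by linarith) (by linarith)
  · rw [add_sub_cancel_right]
    exact le_mul_of_le_const_mul (c := 2) (by linarith) (by linarith) (by linarith)
  · rw [add_sub_cancel_right]; linarith
  · rw [sub_neg_eq_add, sub_add_cancel]
    exact le_mul_of_le_const_mul (c := 4) (by linarith) (by linarith) (by linarith)
  · rw [sub_neg_eq_add, sub_add_cancel]
    exact le_mul_of_le_const_mul (c := 2) (by linarith) (by linarith) (by linarith)
  · rw [sub_neg_eq_add, sub_add_cancel, norm_neg]; linarith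

theorem pairAdmissible_of_twoLarge (hK : 0 < K) (hΛ : 12 + 2 * K ≤ Λ) (hQ : 6 * Λ * (1 + K) ≤ Q)
    (hap : a ≠ p) (haq : a ≠ q) (hpq : p ≠ q) (hx : x ∈ twoLarge Λ a p q) (hG : x ∈ Gam K σ) :
    PairAdmissible Q p.succ a p q x := by
  obtain ⟨h1, h2, h3, h4⟩ := hx
  have hQ72 : 72 ≤ Q := by nlinarith
  have hQΛ : 6 * Λ ≤ Q := by nlinarith
  have hp0 := norm_nonneg (x p.succ)
  have hq0 := norm_nonneg (x q.succ)
  have hσ := hG.2 q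
  have hΛq : (12 + 2 * K) * ‖x q.succ‖ ≤ ‖x a.succ‖ :=
    (mul_le_mul_of_nonneg_right hΛ hq0).trans h3
  have hKq : 0 ≤ K * ‖x q.succ‖ := by positivity
  have hr : ‖x q.succ - σ‖ ≤ 1 / 2 * ‖x a.succ‖ := by
    refine (norm_sub_le _ _).trans ?_
    linarith
  have hv := norm_add_bounds (u := x a.succ) hr
  rw [← sub_eq_of_mem_gam hap haq hpq hG] at hv
  have j1 := jap_le_one_add_norm (x a.succ)
  have j2 := jap_le_one_add_norm (x p.succ)
  have j3 := norm_le_jap (x a.succ)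
  have j4 := norm_le_jap (x p.succ)
  have hΛj : Λ * ‖x p.succ‖ ≤ Λ * jap (x p.succ) := by gcongr; linarith
  refine ⟨forall_fin_three hap haq hpq ?_ ?_ ?_, ?_, Or.inl ⟨?_, ?_, ?_⟩,
    Or.inr (Or.inl ⟨?_, ?_, ?_, ?_⟩)⟩
  · exact le_mul_of_one_le_left (by linarith) (by linarith)
  · exact le_mul_of_le_const_mul (c := 1) (by linarith) (by linarith) (by linarith)
  · exact le_mul_of_le_const_mul (c := 1) (by linarith) (by linarith) (by linarith)
  · exact le_mul_of_le_const_mul (c := 2 * Λ) (by linarith) (by linarith) (by linarith)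
  · rw [add_sub_cancel_right]
    exact le_mul_of_le_const_mul (c := 3) (by linarith) (by linarith) (by linarith)
  · rw [add_sub_cancel_right]
    exact le_mul_of_le_const_mul (c := Λ) (by linarith) (by linarith) (by linarith)
  · rw [add_sub_cancel_right]; linarith
  · rw [norm_neg]
    exact le_mul_of_le_const_mul (c := 2 * Λ) (by linarith) (by linarith) (by linarith)
  · rw [norm_neg]
    exact le_mul_of_le_const_mul (c := 1) (by linarith) (by linarith) (by linarith)
  · exact le_mul_of_le_const_mul (c := 4) (by linarith) (by linarith) (by linarith)
  · exact le_mul_of_le_const_mul (c := 2) (by linarith) (by linarith) (by linarith)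

theorem pairAdmissible_of_nondegenerate (hK : 0 < K) (hΛ : 12 + 2 * K ≤ Λ)
    (hQ : 6 * Λ * (1 + K) ≤ Q) (hτ : 0 < τ) (hQτ : 2 / τ ≤ Q)
    (hap : a ≠ p) (haq : a ≠ q) (hpq : p ≠ q) (hx : x ∈ nondegenerate Λ τ a p q)
    (hG : x ∈ Gam K σ) : PairAdmissible Q p.succ a p q x := by
  obtain ⟨⟨h1, h2⟩, h3, h4⟩ := hx
  set N := totalSize x with hN
  have hQΛ : 6 * Λ ≤ Q := by nlinarith
  have hΛ0 : 0 < Λ := by linarith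
  have hle := norm_le_totalSize x
  have hj : ∀ j : Fin 3, jap (x j.succ) ≤ 2 * N := fun j => by
    have := jap_le_one_add_norm (x j.succ)
    linarith [hle j]
  have hjN : ∀ j : Fin 3, N ≤ 3 * Λ * jap (x j.succ) := fun j => by
    have := h2 j
    have := mul_le_mul_of_nonneg_left (norm_le_jap (x j.succ)) (by positivity : 0 ≤ 3 * Λ)
    linarith
  have hτ' : ∀ {B : ℝ}, τ * N ≤ B → 2 * N ≤ Q * B := by
    intro B hB
    have hB0 : 0 ≤ B := le_trans (by positivity) hB
    refine le_mul_of_le_const_mul ?_ hQτ hB0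
    calc 2 * N = 2 / τ * (τ * N) := by field_simp
      _ ≤ _ := by gcongr
  have hsum : ‖x 0 - x p.succ‖ ≤ 2 * ((1 + K) * N) := by
    rw [sub_eq_of_mem_gam hap haq hpq hG]
    have h5 := norm_add_le (x a.succ) (x q.succ - σ)
    have h6 := norm_sub_le (x q.succ) σ
    have h7 := hG.2 q
    have h8 : K * ‖x q.succ‖ ≤ K * N := by gcongr; exact hle q
    have := hle a
    have := hle q
    have : 0 ≤ K * N := by positivity
    linarith
  refine ⟨fun j => ?_, ?_, Or.inr (Or.inl ⟨?_, ?_, ?_, ?_⟩), Or.inr (Or.inl ⟨?_, ?_, ?_, ?_⟩)⟩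
  · exact le_mul_of_le_const_mul (c := 3 * Λ) ((hle j).trans (h2 a)) (by linarith) (norm_nonneg _)
  · refine le_mul_of_le_const_mul (c := 6 * Λ) ?_ hQΛ (jap_pos _).le
    linarith [hj a, hjN p]
  · refine le_mul_of_le_const_mul (c := 6 * Λ) ?_ hQΛ (norm_nonneg _)
    linarith [hj p, h2 q]
  · refine le_mul_of_le_const_mul (c := 3 * Λ) ?_ (by linarith) (jap_pos _).le
    linarith [hle q, hjN p]
  · exact (hj p).trans (hτ' h3)
  · refine le_mul_of_le_const_mul (c := 6 * Λ) ?_ hQΛ (jap_pos _).le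
    linarith [hle a, hle q, hjN p, norm_add_le (x a.succ) (x q.succ)]
  · rw [norm_neg]
    refine le_mul_of_le_const_mul (c := 6 * Λ) ?_ hQΛ (norm_nonneg _)
    linarith [hj a, h2 p]
  · rw [norm_neg]
    refine le_mul_of_le_const_mul (c := 3 * Λ) ?_ (by linarith) (jap_pos _).le
    linarith [hle p, hjN a]
  · exact (hj a).trans (hτ' h4)
  · refine le_mul_of_le_const_mul (c := 6 * Λ * (1 + K)) ?_ hQ (jap_pos _).le
    calc ‖x 0 - x p.succ‖ ≤ 2 * ((1 + K) * N) := hsum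
      _ ≤ 2 * ((1 + K) * (3 * Λ * jap (x a.succ))) := by
          gcongr
          exact hjN a
      _ = _ := by ring

theorem pairAdmissible_of_allSmall (hQ : 2 ≤ Q) (hx : x ∈ allSmall a) :
    PairAdmissible Q p.succ a p q x := by
  obtain ⟨h1, h2⟩ := hx
  have hj : ∀ j : Fin 3, jap (x j.succ) ≤ 2 := fun j => by
    linarith [jap_le_one_add_norm (x j.succ), h1 j]
  refine ⟨fun j => ?_, ?_, Or.inr (Or.inr ⟨?_, ?_⟩), Or.inr (Or.inr ⟨?_, ?_⟩)⟩
  · exact (h1 j).trans (le_mul_of_one_le_left (norm_nonneg _) (by linarith))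
  · exact le_mul_of_le_const_mul (c := 2) (by linarith [hj a, one_le_jap (x p.succ)]) hQ
      (jap_pos _).le
  · exact (hj p).trans hQ
  · linarith [h1 q]
  · exact (hj a).trans hQ
  · rw [norm_neg]; linarith [h1 p]

end Regions

theorem isAvoidable_three {c : ℝ} (hc : c ∈ ({2, -2} : Finset ℝ)) : IsAvoidable 3 c := by
  intro K hK h
  have hK' : (3 : ℝ) ≤ K := by exact_mod_cast hK
  have h0 : 0 < ((3 : ℕ) : ℝ) / (K : ℝ) := by push_cast; positivity
  have h1 : ((3 : ℕ) : ℝ) / (K : ℝ) ≤ 1 := by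
    push_cast
    rw [div_le_one (by linarith)]
    exact hK'
  simp only [Finset.mem_insert, Finset.mem_singleton] at hc
  rcases hc with rfl | rfl <;> linarith

theorem compl_outgoing_pair {a p q : Fin 3} (hap : a ≠ p) (haq : a ≠ q) (hpq : p ≠ q) :
    ({0, p.succ} : Finset (Fin 4))ᶜ = {a.succ, q.succ} := by
  revert a p q; decide

/-- The ordered triples of distinct ingoing indices. -/
abbrev IndexTriple : Type :=
  {t : Fin 3 × Fin 3 × Fin 3 // t.1 ≠ t.2.1 ∧ t.1 ≠ t.2.2 ∧ t.2.1 ≠ t.2.2}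

/-- The regions into which the frequency space is cut. -/
def region {d : ℕ} (Λ τ : ℝ) (i : IndexTriple × Fin 6) : Set (Config 3 d) :=
  ![oneLarge Λ i.1.1.1 i.1.1.2.1 i.1.1.2.2, twoLarge Λ i.1.1.1 i.1.1.2.1 i.1.1.2.2,
    nondegenerate Λ τ i.1.1.1 i.1.1.2.1 i.1.1.2.2, allSmall i.1.1.1, nearEqual Λ τ,
    nearOpposite Λ τ i.1.1.1 i.1.1.2.1 i.1.1.2.2] i.2

theorem measurableSet_region {d : ℕ} (Λ τ : ℝ) (i : IndexTriple × Fin 6) :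
    MeasurableSet (region Λ τ i : Set (Config 3 d)) := by
  obtain ⟨t, k⟩ := i
  fin_cases k
  exacts [measurableSet_oneLarge _ _ _ _, measurableSet_twoLarge _ _ _ _,
    measurableSet_nondegenerate _ _ _ _ _, measurableSet_allSmall _, measurableSet_nearEqual _ _,
    measurableSet_nearOpposite _ _ _ _ _]

theorem iUnion_region {d : ℕ} {Λ τ : ℝ} (hΛ : 1 ≤ Λ) (hτ : 24 * τ * Λ ≤ 1) :
    (⋃ i, region Λ τ i : Set (Config 3 d)) = Set.univ := by
  refine Set.eq_univ_of_forall fun x => Set.mem_iUnion.2 ?_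
  obtain ⟨a, p, q, hap, haq, hpq, h⟩ := region_cover hΛ hτ x
  set t : IndexTriple := ⟨(a, p, q), hap, haq, hpq⟩
  rcases h with h | h | h | h | h | h
  exacts [⟨(t, 0), h⟩, ⟨(t, 1), h⟩, ⟨(t, 2), h⟩, ⟨(t, 3), h⟩, ⟨(t, 4), h⟩, ⟨(t, 5), h⟩]

/-- The pair of estimates which the flexible frequency-restricted estimate requires on a single region
`R`, with the avoided values `2` and `-2`. -/
def RegionEstimate {d : ℕ} (L : Freq d → ℝ) (m : Config 3 d → ℝ) (s ε K κ δ : ℝ)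
    (R : Set (Config 3 d)) (C η : ℝ) : Prop :=
  ∃ (c : ℝ) (A : Finset (Fin 4)) (t t' : Fin 4 → ℝ) (e e' : ℝ),
    c ∈ ({2, -2} : Finset ℝ) ∧ A.Nonempty ∧ A ≠ Finset.univ ∧
    (∀ j, t j + t' j = 2 * s) ∧ e + e' = 2 * ε ∧
    Estimate L (fun σ => R ∩ (Gam K σ ∩ Avoid κ δ c σ)) (weight m t e) Aᶜ C η ∧
    Estimate L (fun σ => R ∩ (Gam K σ ∩ Avoid κ δ c σ)) (weight m t' e') A C η

/-- A region on which a value of `σ/ξ` is avoided altogether contributes nothing. -/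
theorem regionEstimate_of_forall_notMem {d : ℕ} {L : Freq d → ℝ} {m : Config 3 d → ℝ}
    {s ε K κ δ C η c : ℝ} {R : Set (Config 3 d)} (hc : c ∈ ({2, -2} : Finset ℝ))
    (hR : ∀ σ x, x ∈ R → x ∈ Gam K σ → x ∉ Avoid κ δ c σ) :
    RegionEstimate L m s ε K κ δ R C η := by
  have hempty : ∀ σ, R ∩ (Gam K σ ∩ Avoid κ δ c σ) = ∅ := fun σ =>
    Set.eq_empty_of_forall_notMem fun x hx => hR σ x hx.1 hx.2.1 hx.2.2
  exact ⟨c, {0}, fun _ => s, fun _ => s, ε, ε, hc, ⟨0, by simp⟩, by decide, fun _ => by ring,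
    by ring, estimate_of_eq_empty hempty, estimate_of_eq_empty hempty⟩

/-- The flexible estimate for every multiplier of size at most `|ξ| + |σ|`, in terms of an auxiliary
regularity `s' ≤ s` slightly above the scaling-critical one. -/
theorem flexibleEstimate_of_multiplier_le {n : ℕ} (hd : 0 < n + 3) {m : Config 3 (n + 3) → ℝ}
    {s s' ε e θ : ℝ} (hm : ∀ K σ x, x ∈ Gam K σ → |m x| ≤ ‖x 0‖ + ‖σ‖) (hs' : 0 ≤ s')
    (hss' : s' ≤ s) (he : 0 ≤ e) (hεe : ε ≤ e) (hθ0 : 0 < θ) (hθ1 : θ ≤ 1)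
    (hsn : 2 * s' < n + 2) (hse : 2 * s' = n + 1 + e + 3 * θ) :
    FlexibleEstimate (k := 3) (zkSymbol hd) m {2, -2} s ε := by
  refine ⟨fun c hc => isAvoidable_three hc, fun K κ δ hK hκ hδ => ?_⟩
  set Λ : ℝ := 12 + 2 * K with hΛ
  have hΛ0 : 0 < Λ := by positivity
  set τ : ℝ := min 1 (min (κ - 1) δ) / (24 * Λ) with hτdef
  have hmin : 0 < min 1 (min (κ - 1) δ) := lt_min one_pos (lt_min (by linarith) hδ)
  have hτ : 0 < τ := by positivity
  have hτΛ : 24 * τ * Λ = min 1 (min (κ - 1) δ) := by rw [hτdef]; field_simp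
  have hτ1 : 24 * τ * Λ ≤ 1 := hτΛ ▸ min_le_left _ _
  have hτκ : 24 * τ * Λ ≤ κ - 1 := hτΛ ▸ (min_le_right _ _).trans (min_le_left _ _)
  have hτδ : 24 * τ * Λ ≤ δ := hτΛ ▸ (min_le_right _ _).trans (min_le_right _ _)
  have hτΛ0 : 0 < τ * Λ := by positivity
  -- `Λ` separates the sizes, `τ` is small in terms of `κ` and `δ`, and `Q` bounds all ratios.
  set Q : ℝ := 6 * Λ * (1 + K) + 2 / τ with hQdef
  have hQ0 : 0 < Q := by positivity
  have hQ1 : 6 * Λ * (1 + K) ≤ Q := by rw [hQdef]; linarith [(by positivity : 0 < 2 / τ)]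
  have hQ2 : 2 / τ ≤ Q := by rw [hQdef]; linarith [(by positivity : 0 < 6 * Λ * (1 + K))]
  have hQ3 : 2 ≤ Q := by nlinarith
  obtain ⟨C₁, h₁⟩ := estimate_ingoing_pair (Q := Q) hd (hm K) hs' hss' he hεe hθ0 hθ1 hsn hse hK.le
    hQ0
  obtain ⟨C₂, h₂⟩ := estimate_outgoing_pair (Q := Q) hd (hm K) hs' hss' he hεe hθ0 hθ1 hsn hse hK.le
    hQ0
  have hgood : ∀ (R : Set (Config 3 (n + 3))) (a p q : Fin 3) (i : Fin 4), a ≠ p → a ≠ q → p ≠ q →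
      i ≠ a.succ → i ≠ q.succ →
      (∀ σ x, x ∈ R → x ∈ Gam K σ → PairAdmissible Q i a p q x) →
      RegionEstimate (zkSymbol hd) m s ε K κ δ R (max C₁ C₂) θ := by
    intro R a p q i hap haq hpq hia hiq hR
    refine ⟨2, {0, p.succ}, pairExponent s s' p q, pairExponent s s' q p, ε, ε, by simp,
      ⟨0, by simp⟩, ?_, pairExponent_add_swap s s' hpq, by ring, ?_, ?_⟩
    · intro h
      have h2 := compl_outgoing_pair hap haq hpq
      rw [h, Finset.compl_univ] at h2
      exact absurd h2.symm (Finset.insert_ne_empty _ _)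
    · rw [compl_outgoing_pair hap haq hpq]
      refine (h₁ a p q i _ hap haq hpq hia hiq fun σ x hx => ?_).mono_const (le_max_left _ _)
      obtain ⟨hb, hc, hd, -⟩ := hR σ x hx.1 hx.2.1
      exact ⟨hx.2.1, hb, hc, hd⟩
    · refine (h₂ a p q _ hap haq hpq fun σ x hx => ?_).mono_const (le_max_right _ _)
      obtain ⟨hb, -, -, hd⟩ := hR σ x hx.1 hx.2.1
      exact ⟨hx.2.1, hb, hd⟩
  set E := Fintype.equivFin (IndexTriple × Fin 6)
  refine ⟨θ, max C₁ C₂, _, fun i => region Λ τ (E.symm i), hθ0,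
    fun i => measurableSet_region _ _ _, ?_, fun i => ?_⟩
  · rw [E.symm.surjective.iUnion_comp (region Λ τ)]
    exact iUnion_region (by linarith) hτ1
  change RegionEstimate (zkSymbol hd) m s ε K κ δ (region Λ τ (E.symm i)) (max C₁ C₂) θ
  obtain ⟨⟨⟨a, p, q⟩, hap, haq, hpq⟩, k⟩ := E.symm i
  simp only at hap haq hpq
  have h0a : (0 : Fin 4) ≠ a.succ := (Fin.succ_ne_zero _).symm
  have h0q : (0 : Fin 4) ≠ q.succ := (Fin.succ_ne_zero _).symm
  have hpa' : p.succ ≠ a.succ := fun h => hap (Fin.succ_injective _ h).symm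
  have hpq' : p.succ ≠ q.succ := fun h => hpq (Fin.succ_injective _ h)
  fin_cases k
  · exact hgood _ a p q 0 hap haq hpq h0a h0q fun σ x hx hG =>
      pairAdmissible_of_oneLarge hK hΛ.ge hQ1 hap haq hpq hx hG
  · exact hgood _ a p q p.succ hap haq hpq hpa' hpq' fun σ x hx hG =>
      pairAdmissible_of_twoLarge hK hΛ.ge hQ1 hap haq hpq hx hG
  · exact hgood _ a p q p.succ hap haq hpq hpa' hpq' fun σ x hx hG =>
      pairAdmissible_of_nondegenerate hK hΛ.ge hQ1 hτ hQ2 hap haq hpq hx hG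
  · exact hgood _ a p q p.succ hap haq hpq hpa' hpq' fun σ x hx hG =>
      pairAdmissible_of_allSmall hQ3 hx
  · exact regionEstimate_of_forall_notMem (c := 2) (by simp) fun σ x hx hG =>
      notMem_avoid_of_nearEqual (by linarith) hδ (by linarith) hτ1 hΛ0 hx hG
  · exact regionEstimate_of_forall_notMem (c := -2) (by simp) fun σ x hx hG =>
      notMem_avoid_of_nearOpposite hap haq hpq (by linarith) hδ (by linarith) hτ1 hΛ0 hx hG

theorem abs_outSize_le {k d : ℕ} (x : Config k d) (σ : Freq d) : |outSize x| ≤ ‖x 0‖ + ‖σ‖ := by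
  rw [outSize, abs_norm]
  linarith [norm_nonneg σ]

theorem abs_zkMultiplier_le {k d : ℕ} (hd : 0 < d) {K : ℝ} {σ : Freq d} {x : Config k d}
    (hx : x ∈ Gam K σ) : |zkMultiplier hd x| ≤ ‖x 0‖ + ‖σ‖ := by
  rw [zkMultiplier, ← hx.1]
  exact (abs_coord_le_norm _ _).trans (norm_add_le _ _)

end FlexFRE

end

theorem proposition4p1 (d : ℕ) (hd : 3 ≤ d) (s ε : ℝ) (hs : (d : ℝ) / 2 - 1 < s)
    (hε : ε < min (2 * s - d + 2) 1) :
    FlexFRE.FlexibleEstimate (k := 3) (FlexFRE.zkSymbol (d := d) (by omega))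
        FlexFRE.outSize {2, -2} s ε ∧
      FlexFRE.FlexibleEstimate (k := 3) (FlexFRE.zkSymbol (d := d) (by omega))
        (FlexFRE.zkMultiplier (by omega)) {2, -2} s ε := by
  obtain ⟨n, rfl⟩ : ∃ n, d = n + 3 := ⟨d - 3, by omega⟩
  push_cast at hs hε
  set g : ℝ := min (2 * s - (n + 3) + 2) 1 with hg
  have hg0 : 0 < g := lt_min (by linarith) one_pos
  have hg1 : g ≤ 1 := min_le_right _ _
  have hg2 : g ≤ 2 * s - (n + 3) + 2 := min_le_left _ _
  -- The gain is raised to `e = max ε 0`; the auxiliary regularity exceeds the critical one by half of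
  -- the mean of `e` and `g`, and the excess over the gain is `3θ`.
  set e : ℝ := max ε 0 with he
  have he0 : 0 ≤ e := le_max_right _ _
  have hεe : ε ≤ e := le_max_left _ _
  have heg : e < g := max_lt hε hg0
  have hn : (0 : ℝ) ≤ n := n.cast_nonneg
  constructor
  · exact FlexFRE.flexibleEstimate_of_multiplier_le (s' := (n + 1 + (e + g) / 2) / 2) (e := e)
      (θ := (g - e) / 6) _ (fun K σ x _ => FlexFRE.abs_outSize_le x σ) (by linarith) (by linarith)
      he0 hεe (by linarith) (by linarith) (by linarith) (by ring)
  · exact FlexFRE.flexibleEstimate_of_multiplier_le (s' := (n + 1 + (e + g) / 2) / 2) (e := e)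
      (θ := (g - e) / 6) _ (fun K σ x hx => FlexFRE.abs_zkMultiplier_le _ hx) (by linarith)
      (by linarith) he0 hεe (by linarith) (by linarith) (by linarith) (by ring)
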